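/- **Model.** Fix sets of identifiers, role names, function symbols, labels, claim names (among them $\mathit{secret}$), agents (a subset of which is trusted), run identifiers, and a non-empty set $\mathcal{IT}$ of intruder-generated atoms. *Role terms* are built from identifiers, role names and function terms $f(x_1,\dots,x_n)$ by pairing $(x,y)$ and encryption $\{x\}_y$. *Run terms* are built in the same way from agents, function terms and *nonces*; a nonce is a $c\sharp rid$ ($c$ an identifier, $rid$ a run identifier) or an element of $\mathcal{IT}$. The *subterms* of a term are the term itself and the subterms of the components of a pair and of the body and key of an encryption (not of function arguments). An involution of the function symbols gives inverse keys, $f(\vec t)^{-1}=f^{-1}(\vec t)$; every other term is its own inverse. A *role specification* of role $r$ is a list of events executed by $r$, starting with its only $\mathsf{create}_l(r)$ event and terminated by its only $\mathsf{end}_l(r)$ event, with events $\mathsf{send}_l(r,r',m)$, $\mathsf{read}_l(r',r,m)$ (sender $r'$, recipient $r$) and $\mathsf{claim}_l(r,cl[,m])$ in between, together with a map typing each identifier as constant, parameter or variable. A *protocol* is a partial map from role names to role specifications of those roles, in which labels are unique, except that a send and the corresponding read (same sender and recipient) carry the same label. In a *protocol set* no label is used in two protocols. Write $l\in\Pi$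 if $l$ is the label of an event of a protocol in $\Pi$. An *instantiation* is a triple $inst=(rid,\rho,\sigma)$ with $\rho$ a partial map from role names to agents and $\sigma$ a partial map from identifiers to nonces. It replaces roles $r$ by $\rho(r)$, constants $c$ by $c\sharp rid$, and parameters and variables $x$ by $\sigma(x)$. A *run* consists of an instantiation and a list of remaining events. It is *initial* for a role of $P$ if the list is the full event list of that role, $\mathrm{dom}\,\rho=\mathrm{dom}\,P$, and $\mathrm{dom}\,\sigma$ is the set of parameters of the role. The *closure* of a set of run terms is its closure under pairing, projections, encryption ($u,v\mapsto\{u\}_v$) and decryption ($\{u\}_v,v^{-1}\mapsto u$). The *initial intruder knowledge* $M_0$, the same for all protocol sets, is the closure of all agent names, all of $\mathcal{IT}$, and a given set of long-term keys $f(a_1,\dots,a_n)$ with agents $a_i$. The system for $\Pi$ starts with intruder knowledge $M_0$ and no runs. Its transitions, labelled by run events $(inst,ev)$, are: - create an initial run of a role of a protocol in $\Pi$ with an unused run identifier; - execute the next event of a run. A send adds $inst(m)$ to the intruder knowledge, which is then closed. A read requires an extension of $\sigma$ by values for exactly the still unassigned variables of $m$, such that $inst(m)$ becomes a term known to the intruder;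 the run continues with the extended instantiation, which is the one recorded in the run event. Claim and end events are always executable. $\mathrm{Tr}(\Pi)$ is the set of the resulting finite traces. A *trace restriction* $\chi$ is a predicate on traces (*empty* if it always holds). A secrecy claim label $l$ is *satisfied by* $\Pi$ *under* $\chi$ if for every $\alpha\in\mathrm{Tr}(\Pi)$ with $\chi(\alpha)$ and every run event $(inst,\mathsf{claim}_l(r,\mathit{secret},m))$ of $\alpha$ in which all agents in the image of $\rho$ are trusted, $inst(m)$ is not in the intruder knowledge at the end of $\alpha$. Protocol sets $\Pi_1,\Pi_2$ are *independent in the context of* $\chi$ if they are disjoint and, for every $\alpha\in\mathrm{Tr}(\Pi_1\cup\Pi_2)$ with $\chi(\alpha)$, whenever a send event of $\alpha$ with label $l$ and a send, read or claim event of $\alpha$ with label $l'$ have encryption subterms $\{x\}_y$, $\{x'\}_{y'}$ of their role terms with equal instances, then $l,l'\in\Pi_1$ or $l,l'\in\Pi_2$. **Theorem.** Let $\Pi_1\cup\Pi_2$ be a protocol set in whose sent and read messages secret long-term keys are used only as keys: a function term that has an instance outside $M_0$ occurs there only inside the key of an encryption. Let $\chi$ be a (possibly empty) trace restriction such that, in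 every $\alpha\in\mathrm{Tr}(\Pi_1\cup\Pi_2)$ with $\chi(\alpha)$, no run of a role of $\Pi_2$ is created with a parameter whose value is a nonce $c\sharp rid$ generated by a run of a role of $\Pi_1$ in $\alpha$ (that is, $rid$ is the identifier of that run and $c$ a constant of its role), unless the intruder already knows this nonce at that moment. (If the protocols of $\Pi_2$ have no parameters, this holds for the empty $\chi$.) Suppose that $\Pi_1$ and $\Pi_2$ are independent in the context of $\chi$, and let $l$ be the label of a secrecy claim event in $\Pi_1$. If $\Pi_1$ satisfies $l$ (under no trace restriction), then $\Pi_1\cup\Pi_2$ satisfies $l$ under $\chi$. In particular, if the protocols of $\Pi_2$ have no parameters and $\Pi_1,\Pi_2$ are independent, then $\Pi_1\cup\Pi_2$ satisfies $l$ whenever $\Pi_1$ does. -/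

import Mathlib

namespace SecProt

/-! The symbolic model: role terms, role specifications, protocols, run terms, intruder, traces. -/

/-- The sets over which the model is built: identifiers, role names, (global) function symbols,
labels, claim names other than secrecy, agent names, run identifiers, and atoms generated by
the intruder.  `inv` sends the symbol of a long-term key to the symbol of its inverse key
(`pk` to `sk`, a symmetric key symbol to itself), `trusted` is the set of trusted agents, and
`initKeys` is the set of long-term keys `f(a₁, …, aₙ)` the intruder knows from the start
(such as all public keys and all secret keys of compromised agents). -/
structure Vocabulary where
  Ident : Type*
  Role : Type*
  Fn : Type*
  Label : Type*
  OtherClaim : Type*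
  Agent : Type*
  RunId : Type*
  IntruderAtom : Type*
  inv : Fn → Fn
  inv_inv : ∀ f, inv (inv f) = f
  trusted : Set Agent
  initKeys : Set (Fn × List Agent)

/-! ### Role terms, events, protocols -/

/-- Role terms: identifiers, role names, `f(x₁, …, xₙ)`, tuples `(x, y)`, encryptions `{x}_y`. -/
inductive RoleTerm (V : Vocabulary)
  | ident (c : V.Ident)
  | role (r : V.Role)
  | func (f : V.Fn) (n : ℕ) (args : Fin n → RoleTerm V)
  | pair (x y : RoleTerm V)
  | enc (x y : RoleTerm V)

/-- The identifiers that appear in a role term. -/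
def RoleTerm.idents {V : Vocabulary} : RoleTerm V → Set V.Ident
  | .ident c => {c}
  | .role _ => ∅
  | .func _ _ args => ⋃ i, (args i).idents
  | .pair x y => x.idents ∪ y.idents
  | .enc x y => x.idents ∪ y.idents

/-- `Subterm x y` is `x ⊑ y`; the arguments of a function term are not subterms of it. -/
inductive Subterm {V : Vocabulary} : RoleTerm V → RoleTerm V → Prop
  | refl (x : RoleTerm V) : Subterm x x
  | pair_left {x y z : RoleTerm V} : Subterm x y → Subterm x (.pair y z)
  | pair_right {x y z : RoleTerm V} : Subterm x z → Subterm x (.pair y z)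
  | enc_body {x y z : RoleTerm V} : Subterm x y → Subterm x (.enc y z)
  | enc_key {x y z : RoleTerm V} : Subterm x z → Subterm x (.enc y z)

/-- `ContentOf x m`: `x` occurs in `m` as content, that is, not inside the key of an encryption. -/
inductive ContentOf {V : Vocabulary} : RoleTerm V → RoleTerm V → Prop
  | refl (x : RoleTerm V) : ContentOf x x
  | pair_left {x y z : RoleTerm V} : ContentOf x y → ContentOf x (.pair y z)
  | pair_right {x y z : RoleTerm V} : ContentOf x z → ContentOf x (.pair y z)
  | enc_body {x y z : RoleTerm V} : ContentOf x y → ContentOf x (.enc y z)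

inductive ClaimName (V : Vocabulary)
  | secret
  | other (c : V.OtherClaim)

/-- Events.  In both `send` and `read` the first role is the sender and the second the recipient
of the message. -/
inductive Event (V : Vocabulary)
  | create (l : V.Label) (r : V.Role)
  | send (l : V.Label) (sender recipient : V.Role) (m : RoleTerm V)
  | read (l : V.Label) (sender recipient : V.Role) (m : RoleTerm V)
  | claim (l : V.Label) (r : V.Role) (cl : ClaimName V) (m : Option (RoleTerm V))
  | finish (l : V.Label) (r : V.Role)

namespace Event

variable {V : Vocabulary}

def label : Event V → V.Label
  | create l _ => l
  | send l _ _ _ => l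
  | read l _ _ _ => l
  | claim l _ _ _ => l
  | finish l _ => l

/-- The role that executes the event. -/
def actor : Event V → V.Role
  | create _ r => r
  | send _ s _ _ => s
  | read _ _ r _ => r
  | claim _ r _ _ => r
  | finish _ r => r

/-- The event is neither a `create` nor a `finish` event. -/
def Inner : Event V → Prop
  | create _ _ => False
  | finish _ _ => False
  | _ => True

/-- A send and a read event that correspond to each other. -/
def Corresponds (e e' : Event V) : Prop :=
  ∃ l s r m m', e = send l s r m ∧ e' = read l s r m'

/-- `m` is the message of the send event `e`. -/
def Sends (e : Event V) (m : RoleTerm V) : Prop :=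
  ∃ l s r, e = send l s r m

/-- `m` is the term of the read, send or claim event `e`. -/
def Mentions (e : Event V) (m : RoleTerm V) : Prop :=
  (∃ l s r, e = read l s r m) ∨ (∃ l s r, e = send l s r m) ∨
    ∃ l r cl, e = claim l r cl (some m)

end Event

inductive IdentType
  | const
  | param
  | var

/-- A role specification: a list of events and the types of the identifiers. -/
structure RoleSpec (V : Vocabulary) where
  elist : List (Event V)
  typ : V.Ident → IdentType

/-- The role specification has role name `r`: it starts with its only `create` event, ends with
its only `finish` event, and all its events are executed by `r`. -/
def RoleSpec.WellFormed {V : Vocabulary} (rs : RoleSpec V) (r : V.Role) : Prop :=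
  ∃ l l' body, rs.elist = Event.create l r :: (body ++ [Event.finish l' r]) ∧
    ∀ e ∈ body, e.Inner ∧ e.actor = r

/-- A protocol is a partial map from role names to role specifications. -/
abbrev Protocol (V : Vocabulary) := V.Role → Option (RoleSpec V)

namespace Protocol

variable {V : Vocabulary}

/-- `l ∈ P`: the label `l` is the label of an event of `P`. -/
def HasLabel (P : Protocol V) (l : V.Label) : Prop :=
  ∃ r rs e, P r = some rs ∧ e ∈ rs.elist ∧ e.label = l

/-- Every `P r` is a role specification with role name `r`, and labels are unique except for the
identical labels of corresponding send and read events. -/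
def WellFormed (P : Protocol V) : Prop :=
  (∀ r rs, P r = some rs → rs.WellFormed r) ∧
  ∀ r rs (i : ℕ) e r' rs' (i' : ℕ) e', P r = some rs → P r' = some rs' →
    rs.elist[i]? = some e → rs'.elist[i']? = some e' → e.label = e'.label →
    (r = r' ∧ i = i') ∨ e.Corresponds e' ∨ e'.Corresponds e

end Protocol

/-- `l ∈ S`: the label `l` occurs in a protocol of the set `S`. -/
def LabelIn {V : Vocabulary} (S : Set (Protocol V)) (l : V.Label) : Prop :=
  ∃ P ∈ S, P.HasLabel l

/-- A protocol set: well-formed protocols, no label used in more than one of them. -/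
def IsProtocolSet {V : Vocabulary} (S : Set (Protocol V)) : Prop :=
  (∀ P ∈ S, P.WellFormed) ∧
  ∀ P ∈ S, ∀ Q ∈ S, ∀ l, P.HasLabel l → Q.HasLabel l → P = Q

/-! ### Run terms and instantiations -/

/-- Nonce run terms: `c#rid` (`fresh`), and the terms generated by the intruder. -/
inductive Nonce (V : Vocabulary)
  | fresh (c : V.Ident) (rid : V.RunId)
  | intruder (x : V.IntruderAtom)

inductive RunTerm (V : Vocabulary)
  | agent (a : V.Agent)
  | nonce (n : Nonce V)
  | func (f : V.Fn) (n : ℕ) (args : Fin n → RunTerm V)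
  | pair (t u : RunTerm V)
  | enc (t u : RunTerm V)

/-- The inverse of a term seen as a key: only long-term keys can differ from their inverse. -/
def RunTerm.inverse {V : Vocabulary} : RunTerm V → RunTerm V
  | .func f n args => .func (V.inv f) n args
  | t => t

/-- An instantiation `(rid, ρ, σ)`, together with the type function of the role specification in
whose context it is applied.  Variables and parameters are assigned nonce run terms only. -/
structure Inst (V : Vocabulary) where
  rid : V.RunId
  typ : V.Ident → IdentType
  rho : V.Role → Option V.Agent
  sigma : V.Ident → Option (Nonce V)

namespace Inst

variable {V : Vocabulary}

/-- The run term `inst(x)`, or `none` when the instantiation cannot be applied to `x`. -/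
def apply (inst : Inst V) : RoleTerm V → Option (RunTerm V)
  | .ident c =>
    match inst.typ c with
    | .const => some (.nonce (.fresh c inst.rid))
    | .param => (inst.sigma c).map .nonce
    | .var => (inst.sigma c).map .nonce
  | .role r => (inst.rho r).map .agent
  | .func f n args =>
    if h : ∀ i, (inst.apply (args i)).isSome then
      some (.func f n fun i => (inst.apply (args i)).get (h i))
    else none
  | .pair x y => (inst.apply x).bind fun t => (inst.apply y).map fun u => .pair t u
  | .enc x y => (inst.apply x).bind fun t => (inst.apply y).map fun u => .enc t u

/-- `Match(inst, m, t, inst')`. -/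
def Matches (inst : Inst V) (m : RoleTerm V) (t : RunTerm V) (inst' : Inst V) : Prop :=
  inst'.rid = inst.rid ∧ inst'.typ = inst.typ ∧ inst'.rho = inst.rho ∧
  (∀ c n, inst.sigma c = some n → inst'.sigma c = some n) ∧
  (∀ c, (inst'.sigma c).isSome ↔
    (inst.sigma c).isSome ∨ (c ∈ m.idents ∧ inst.typ c = .var)) ∧
  inst'.apply m = some t

/-- All roles are played by trusted agents. -/
def AllTrusted (inst : Inst V) : Prop :=
  ∀ r a, inst.rho r = some a → a ∈ V.trusted

end Inst

/-! ### The intruder -/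

/-- Derivability of run terms; `closure S` below is the smallest closed superset of `S`. -/
inductive Derivable {V : Vocabulary} (S : Set (RunTerm V)) : RunTerm V → Prop
  | base {t : RunTerm V} : t ∈ S → Derivable S t
  | pair {t u : RunTerm V} : Derivable S t → Derivable S u → Derivable S (.pair t u)
  | fst {t u : RunTerm V} : Derivable S (.pair t u) → Derivable S t
  | snd {t u : RunTerm V} : Derivable S (.pair t u) → Derivable S u
  | encrypt {t u : RunTerm V} : Derivable S t → Derivable S u → Derivable S (.enc t u)
  | decrypt {t u : RunTerm V} : Derivable S (.enc t u) → Derivable S u.inverse → Derivable S t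

def closure {V : Vocabulary} (S : Set (RunTerm V)) : Set (RunTerm V) :=
  {t | Derivable S t}

/-- The initial intruder knowledge: all agent names, all intruder-generated terms, the long-term
keys in `initKeys`, and what can be derived from them. -/
def initialKnowledge (V : Vocabulary) : Set (RunTerm V) :=
  closure ({t | ∃ a, t = .agent a} ∪ {t | ∃ x, t = .nonce (.intruder x)} ∪
    {t | ∃ f as, (f, as) ∈ V.initKeys ∧ t = .func f as.length fun i => .agent (as.get i)})

/-- `x` is a function term of which some instance is not known to the intruder from the start. -/
def IsSecretKey {V : Vocabulary} (x : RoleTerm V) : Prop :=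
  (∃ f n args, x = .func f n args) ∧
    ∃ (inst : Inst V) (t : RunTerm V), inst.apply x = some t ∧ t ∉ initialKnowledge V

/-- In the messages sent and read by `P`, secret long-term keys are used only as keys. -/
def Protocol.SecretKeysOnlyAsKeys {V : Vocabulary} (P : Protocol V) : Prop :=
  ∀ r rs, P r = some rs → ∀ l s s' m,
    (Event.send l s s' m ∈ rs.elist ∨ Event.read l s s' m ∈ rs.elist) →
    ∀ x, ContentOf x m → ¬ IsSecretKey x

/-! ### Runs and traces -/

/-- A run: an instantiation and the list of the remaining events. -/
structure Run (V : Vocabulary) where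
  inst : Inst V
  rest : List (Event V)

/-- The initial runs of the roles of the protocols in `S`. -/
def initialRuns {V : Vocabulary} (S : Set (Protocol V)) : Set (Run V) :=
  {run | ∃ P ∈ S, ∃ r rs, P r = some rs ∧ run.rest = rs.elist ∧ run.inst.typ = rs.typ ∧
    (∀ r', (run.inst.rho r').isSome ↔ (P r').isSome) ∧
    (∀ c, (run.inst.sigma c).isSome ↔ rs.typ c = .param)}

/-- A run event: an instantiation and an event. -/
structure RunEvent (V : Vocabulary) where
  inst : Inst V
  ev : Event V

/-- A state: the intruder knowledge and the set of active runs. -/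
structure State (V : Vocabulary) where
  know : Set (RunTerm V)
  runs : Set (Run V)

/-- `F[x/y]`. -/
def replaceRun {V : Vocabulary} (F : Set (Run V)) (x y : Run V) : Set (Run V) :=
  insert x (F \ {y})

/-- The derivation rules. -/
inductive Step {V : Vocabulary} (S : Set (Protocol V)) :
    State V → RunEvent V → State V → Prop
  | create {M F inst l r rest} :
      ⟨inst, .create l r :: rest⟩ ∈ initialRuns S →
      (∀ run ∈ F, run.inst.rid ≠ inst.rid) →
      Step S ⟨M, F⟩ ⟨inst, .create l r⟩ ⟨M, F ∪ {⟨inst, rest⟩}⟩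
  | finish {M F inst l r} :
      ⟨inst, [.finish l r]⟩ ∈ F →
      Step S ⟨M, F⟩ ⟨inst, .finish l r⟩ ⟨M, replaceRun F ⟨inst, []⟩ ⟨inst, [.finish l r]⟩⟩
  | send {M F inst l s s' m rest t} :
      ⟨inst, .send l s s' m :: rest⟩ ∈ F →
      inst.apply m = some t →
      Step S ⟨M, F⟩ ⟨inst, .send l s s' m⟩
        ⟨closure (M ∪ {t}), replaceRun F ⟨inst, rest⟩ ⟨inst, .send l s s' m :: rest⟩⟩
  | read {M F inst l s s' m rest t inst'} :
      ⟨inst, .read l s s' m :: rest⟩ ∈ F →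
      t ∈ M →
      inst.Matches m t inst' →
      Step S ⟨M, F⟩ ⟨inst', .read l s s' m⟩
        ⟨M, replaceRun F ⟨inst', rest⟩ ⟨inst, .read l s s' m :: rest⟩⟩
  | claim {M F inst l r cl m rest} :
      ⟨inst, .claim l r cl m :: rest⟩ ∈ F →
      Step S ⟨M, F⟩ ⟨inst, .claim l r cl m⟩
        ⟨M, replaceRun F ⟨inst, rest⟩ ⟨inst, .claim l r cl m :: rest⟩⟩

abbrev Trace (V : Vocabulary) := List (RunEvent V)

/-- `Reaches S α st`: the run events of `α` lead from the initial state to the state `st`. -/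
inductive Reaches {V : Vocabulary} (S : Set (Protocol V)) : Trace V → State V → Prop
  | nil : Reaches S [] ⟨initialKnowledge V, ∅⟩
  | snoc {α st e st'} : Reaches S α st → Step S st e st' → Reaches S (α ++ [e]) st'

/-- The set of valid traces. -/
def traces {V : Vocabulary} (S : Set (Protocol V)) : Set (Trace V) :=
  {α | ∃ st, Reaches S α st}

/-- The intruder knowledge after the first `i` events of `α` (which determine it). -/
def knowledgeAt {V : Vocabulary} (S : Set (Protocol V)) (α : Trace V) (i : ℕ) :
    Set (RunTerm V) :=
  {t | ∃ st, Reaches S (α.take i) st ∧ t ∈ st.know}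

/-! ### Security properties -/

abbrev SecurityProperty (V : Vocabulary) :=
  Set (Protocol V) → Event V → Inst V → Trace V → Prop

/-- Secrecy: the instance of the claimed term is not in the final intruder knowledge. -/
def secrecy (V : Vocabulary) : SecurityProperty V := fun S ev inst α =>
  ∀ l r cl m t, ev = .claim l r cl (some m) → inst.apply m = some t →
    t ∉ knowledgeAt S α α.length

/-- Under the trace restriction `χ`, the set `S` satisfies the claim named `cl` with label `l`,
where `f` is the security property of the claim name `cl`. -/
def Satisfies {V : Vocabulary} (f : SecurityProperty V) (cl : ClaimName V)
    (χ : Trace V → Prop) (S : Set (Protocol V)) (l : V.Label) : Prop :=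
  ∀ α ∈ traces S, χ α → ∀ inst r m, ⟨inst, .claim l r cl m⟩ ∈ α →
    f S (.claim l r cl m) inst α ∨ ¬ inst.AllTrusted

/-- `S` satisfies, under `χ`, the secrecy claim with label `l`. -/
def SatisfiesSecrecy {V : Vocabulary} (χ : Trace V → Prop) (S : Set (Protocol V))
    (l : V.Label) : Prop :=
  Satisfies (secrecy V) .secret χ S l

/-- `l` is the label of a secrecy claim event in a protocol of `S`. -/
def IsSecrecyClaimLabel {V : Vocabulary} (S : Set (Protocol V)) (l : V.Label) : Prop :=
  ∃ P ∈ S, ∃ r rs r' m, P r = some rs ∧ Event.claim l r' .secret (some m) ∈ rs.elist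

/-! ### Independence -/

/-- `S₁` and `S₂` are independent in the context of the trace restriction `χ`. -/
def Independent {V : Vocabulary} (χ : Trace V → Prop) (S₁ S₂ : Set (Protocol V)) : Prop :=
  Disjoint S₁ S₂ ∧
  ∀ α ∈ traces (S₁ ∪ S₂), χ α → ∀ e ∈ α, ∀ e' ∈ α, ∀ m m' x y x' y' t,
    e.ev.Sends m → e'.ev.Mentions m' →
    Subterm (.enc x y) m → Subterm (.enc x' y') m' →
    e.inst.apply (.enc x y) = some t → e'.inst.apply (.enc x' y') = some t →
    (LabelIn S₁ e.ev.label ∧ LabelIn S₁ e'.ev.label) ∨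
      (LabelIn S₂ e.ev.label ∧ LabelIn S₂ e'.ev.label)

/-- The nonce `n` is a constant generated in the trace `α` by a run of a role of `S`. -/
def GeneratedBy {V : Vocabulary} (S : Set (Protocol V)) (α : Trace V) (n : Nonce V) : Prop :=
  ∃ inst l r c, ⟨inst, .create l r⟩ ∈ α ∧ LabelIn S l ∧ inst.typ c = .const ∧
    n = .fresh c inst.rid

/-- In the trace `α` of `S₁ ∪ S₂`, no run of `S₂` receives as the value of a parameter a nonce that
is generated by a run of `S₁`, unless the intruder already knows that nonce. -/
def NoPrivateInput {V : Vocabulary} (S₁ S₂ : Set (Protocol V)) (α : Trace V) : Prop :=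
  ∀ (i : ℕ) inst l r, α[i]? = some ⟨inst, .create l r⟩ → LabelIn S₂ l →
    ∀ p n, inst.sigma p = some n → GeneratedBy S₁ α n →
      RunTerm.nonce n ∈ knowledgeAt (S₁ ∪ S₂) α i

end SecProt

/-! A leak in a trace `α` of `S₁ ∪ S₂` is turned into a leak in a trace of `S₁` alone. The runs of
`S₁` are kept, those of `S₂` are dropped, and the intruder forges what the latter sent. Exact
forgery is impossible, since `S₂` has its own nonces and may encrypt with keys the intruder lacks.
So terms are distorted by `RunTerm.weaken`: a nonce not generated by `S₁` becomes an intruder atom,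
and an encryption from the set `E` of those sent by `S₂` gets an intruder atom as its key. Three
facts make this work.

Weakening respects the intruder's abilities (`weaken_mem_of_derivable`): changed encryptions can be
built and opened with the known atom, and the others keep matching their inverse keys.

Weakening is invisible to `S₁`. By independence the messages and claims of `S₁` have no encryption
in `E`, so they are merely renamed (`Inst.weaken_eq_mapNonce`). The renaming fixes the constants of
`S₁` and there are no inequality tests, so the renamed run is a legitimate run of `S₁`.

Weakened messages of `S₂` are derivable (`Inst.weaken_mem_of_apply`): their encryptions need only
the known atom as key, their function terms are initially known, and their nonces must be either
intruder atoms after renaming or already known. The last point is the subtle one: `S₂` must hold no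
private nonce of `S₁`. The restriction on inputs ensures this at creation. For reads,
`Separated.sigma_mem_publicNonces` maintains that in every known term the nonces of `S₁` outside
encryptions sent by `S₁` are known; by independence a message read by `S₂` has no such encryption to
hide a nonce in.

Both `E` and the renaming are computed from the whole trace `α`, so they stay fixed while the
inductions run over prefixes of `α`. -/

namespace SecProt

variable {V : Vocabulary}

/-! ### Nonces of run terms and renamings -/

/-- The nonces that occur anywhere in a run term. -/
def RunTerm.nonces : RunTerm V → Set (Nonce V)
  | .agent _ => ∅
  | .nonce n => {n}
  | .func _ _ args => ⋃ i, (args i).nonces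
  | .pair t u => t.nonces ∪ u.nonces
  | .enc t u => t.nonces ∪ u.nonces

def RunTerm.mapNonce (θ : Nonce V → Nonce V) : RunTerm V → RunTerm V
  | .agent a => .agent a
  | .nonce n => .nonce (θ n)
  | .func f n args => .func f n fun i => (args i).mapNonce θ
  | .pair t u => .pair (t.mapNonce θ) (u.mapNonce θ)
  | .enc t u => .enc (t.mapNonce θ) (u.mapNonce θ)

open Classical in
/-- Rename the nonces of a run term, and replace the key of every encryption in `E` by the
nonce `k`. -/
noncomputable def RunTerm.weaken (θ : Nonce V → Nonce V) (E : Set (RunTerm V)) (k : Nonce V) :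
    RunTerm V → RunTerm V
  | .agent a => .agent a
  | .nonce n => .nonce (θ n)
  | .func f n args => .func f n fun i => (args i).mapNonce θ
  | .pair t u => .pair (t.weaken θ E k) (u.weaken θ E k)
  | .enc t u => .enc (t.weaken θ E k) (if .enc t u ∈ E then .nonce k else u.weaken θ E k)

theorem RunTerm.weaken_inverse (θ : Nonce V → Nonce V) (E : Set (RunTerm V)) (k : Nonce V)
    (t : RunTerm V) :
    t.inverse.weaken θ E k = (t.weaken θ E k).inverse := by
  cases t <;> simp [inverse, weaken]

/-! ### Closed sets of run terms -/

def IsClosedKnowledge (M : Set (RunTerm V)) : Prop :=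
  ∀ t, Derivable M t → t ∈ M

theorem subset_closure (S : Set (RunTerm V)) : S ⊆ closure S := fun _ h => .base h

theorem isClosedKnowledge_closure (S : Set (RunTerm V)) : IsClosedKnowledge (closure S) := by
  intro t h
  induction h with
  | base h => exact h
  | pair _ _ h₁ h₂ => exact .pair h₁ h₂
  | fst _ h => exact .fst h
  | snd _ h => exact .snd h
  | encrypt _ _ h₁ h₂ => exact .encrypt h₁ h₂
  | decrypt _ _ h₁ h₂ => exact .decrypt h₁ h₂

theorem intruder_mem_initialKnowledge (x : V.IntruderAtom) :
    RunTerm.nonce (.intruder x) ∈ initialKnowledge V :=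
  .base (Or.inl (Or.inr ⟨x, rfl⟩))

theorem agent_mem_initialKnowledge (a : V.Agent) : RunTerm.agent a ∈ initialKnowledge V :=
  .base (Or.inl (Or.inl ⟨a, rfl⟩))

theorem exists_intruder_of_mem_initialKnowledge {t : RunTerm V} (h : t ∈ initialKnowledge V) :
    ∀ n ∈ t.nonces, ∃ x, n = .intruder x := by
  induction h with
  | base h =>
    rcases h with (⟨a, rfl⟩ | ⟨x, rfl⟩) | ⟨f, as, -, rfl⟩
    · simp [RunTerm.nonces]
    · simp [RunTerm.nonces]
    · simp [RunTerm.nonces]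
  | pair _ _ h₁ h₂ => exact fun n hn => hn.elim (h₁ n) (h₂ n)
  | fst _ h => exact fun n hn => h n (Or.inl hn)
  | snd _ h => exact fun n hn => h n (Or.inr hn)
  | encrypt _ _ h₁ h₂ => exact fun n hn => hn.elim (h₁ n) (h₂ n)
  | decrypt _ _ h _ => exact fun n hn => h n (Or.inl hn)

/-- The set `E` may be arbitrary. Replacing a key can only help the intruder, because the
substituted atom is known and is its own inverse. -/
theorem weaken_mem_of_derivable {θ : Nonce V → Nonce V} {E M M' : Set (RunTerm V)}
    {x : V.IntruderAtom} (hM : ∀ t ∈ M, t.weaken θ E (.intruder x) ∈ M')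
    (hM' : IsClosedKnowledge M') (hx : RunTerm.nonce (.intruder x) ∈ M')
    {t : RunTerm V} (h : Derivable M t) :
    t.weaken θ E (.intruder x) ∈ M' := by
  induction h with
  | base h => exact hM _ h
  | pair _ _ h₁ h₂ => exact hM' _ (.pair (.base h₁) (.base h₂))
  | fst _ h => exact hM' _ (.fst (.base h))
  | snd _ h => exact hM' _ (.snd (.base h))
  | encrypt _ _ h₁ h₂ =>
    refine hM' _ (.encrypt (.base h₁) (.base ?_))
    split_ifs
    exacts [hx, h₂]
  | @decrypt t u _ _ h₁ h₂ =>
    -- If the encryption is in `E`, its weakened key is the atom, and the original decryption key is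
    -- not needed. Otherwise weakening commutes with inversion of the key.
    rw [RunTerm.weaken] at h₁
    split_ifs at h₁
    · exact hM' _ (.decrypt (.base h₁) (.base hx))
    · rw [RunTerm.weaken_inverse] at h₂
      exact hM' _ (.decrypt (.base h₁) (.base h₂))

theorem weaken_mem_initialKnowledge {θ : Nonce V → Nonce V}
    (hθ : ∀ y, θ (.intruder y) = .intruder y)
    (E : Set (RunTerm V)) (x : V.IntruderAtom) {t : RunTerm V} (h : t ∈ initialKnowledge V) :
    t.weaken θ E (.intruder x) ∈ initialKnowledge V := by
  refine weaken_mem_of_derivable ?_ (isClosedKnowledge_closure _)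
    (intruder_mem_initialKnowledge x) h
  rintro t ((⟨a, rfl⟩ | ⟨y, rfl⟩) | ⟨f, as, h, rfl⟩)
  · exact agent_mem_initialKnowledge a
  · rw [RunTerm.weaken, hθ]
    exact intruder_mem_initialKnowledge y
  · exact .base (Or.inr ⟨f, as, h, rfl⟩)

/-! ### Instantiated role terms -/

theorem ContentOf.subterm {x m : RoleTerm V} (h : ContentOf x m) : Subterm x m := by
  induction h with
  | refl => exact .refl _
  | pair_left _ h => exact .pair_left h
  | pair_right _ h => exact .pair_right h
  | enc_body _ h => exact .enc_body h

theorem ContentOf.trans {x y m : RoleTerm V} (hx : ContentOf x y) (hy : ContentOf y m) :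
    ContentOf x m := by
  induction hy with
  | refl => exact hx
  | pair_left _ h => exact .pair_left h
  | pair_right _ h => exact .pair_right h
  | enc_body _ h => exact .enc_body h

namespace Inst

variable {inst : Inst V} {t : RunTerm V}

theorem apply_ident_eq_some {c : V.Ident} :
    inst.apply (.ident c) = some t ↔
      (inst.typ c = .const ∧ t = .nonce (.fresh c inst.rid)) ∨
      (inst.typ c ≠ .const ∧ ∃ n, inst.sigma c = some n ∧ t = .nonce n) := by
  cases h : inst.typ c <;> simp [apply, h, eq_comm]

theorem apply_role_eq_some {r : V.Role} :
    inst.apply (.role r) = some t ↔ ∃ a, inst.rho r = some a ∧ t = .agent a := by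
  simp [apply, eq_comm]

theorem apply_func_eq_some {f : V.Fn} {n : ℕ} {args : Fin n → RoleTerm V} :
    inst.apply (.func f n args) = some t ↔
      ∃ ts : Fin n → RunTerm V, (∀ i, inst.apply (args i) = some (ts i)) ∧ t = .func f n ts := by
  rw [apply]
  constructor
  · intro h
    split_ifs at h with hs
    exact ⟨_, fun i => (Option.some_get (hs i)).symm, (Option.some.inj h).symm⟩
  · rintro ⟨ts, hts, rfl⟩
    have hs : ∀ i, (inst.apply (args i)).isSome := fun i => by simp [hts i]
    rw [dif_pos hs]
    simp [hts]

theorem apply_pair_eq_some {x y : RoleTerm V} :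
    inst.apply (.pair x y) = some t ↔
      ∃ u v, inst.apply x = some u ∧ inst.apply y = some v ∧ t = .pair u v := by
  simp only [apply, Option.bind_eq_some_iff, Option.map_eq_some_iff]
  grind

theorem apply_enc_eq_some {x y : RoleTerm V} :
    inst.apply (.enc x y) = some t ↔
      ∃ u v, inst.apply x = some u ∧ inst.apply y = some v ∧ t = .enc u v := by
  simp only [apply, Option.bind_eq_some_iff, Option.map_eq_some_iff]
  grind

def mapNonce (θ : Nonce V → Nonce V) (inst : Inst V) : Inst V :=
  { inst with sigma := fun c => (inst.sigma c).map θ }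

/-- Constants are instantiated from the run identifier and not from `sigma`, so the renaming reaches
them only if it fixes them; this is the role of `hθ`. -/
theorem apply_mapNonce {θ : Nonce V → Nonce V}
    (hθ : ∀ c, inst.typ c = .const → θ (.fresh c inst.rid) = .fresh c inst.rid)
    {m : RoleTerm V} (h : inst.apply m = some t) :
    (inst.mapNonce θ).apply m = some (t.mapNonce θ) := by
  induction m generalizing t with
  | ident c =>
    rw [apply_ident_eq_some] at h ⊢
    rcases h with ⟨hc, rfl⟩ | ⟨hc, n, hn, rfl⟩
    · exact Or.inl ⟨hc, by simp [RunTerm.mapNonce, hθ c hc, mapNonce]⟩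
    · exact Or.inr ⟨hc, θ n, by simp [mapNonce, hn], rfl⟩
  | role r =>
    rw [apply_role_eq_some] at h ⊢
    obtain ⟨a, ha, rfl⟩ := h
    exact ⟨a, ha, rfl⟩
  | func f n args ih =>
    rw [apply_func_eq_some] at h ⊢
    obtain ⟨ts, hts, rfl⟩ := h
    exact ⟨_, fun i => ih i (hts i), rfl⟩
  | pair x y ihx ihy =>
    rw [apply_pair_eq_some] at h ⊢
    obtain ⟨u, v, hu, hv, rfl⟩ := h
    exact ⟨_, _, ihx hu, ihy hv, rfl⟩
  | enc x y ihx ihy =>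
    rw [apply_enc_eq_some] at h ⊢
    obtain ⟨u, v, hu, hv, rfl⟩ := h
    exact ⟨_, _, ihx hu, ihy hv, rfl⟩

theorem nonces_subset_of_apply {N : Set (Nonce V)}
    (hc : ∀ c, inst.typ c = .const → Nonce.fresh c inst.rid ∈ N)
    (hs : ∀ c n, inst.sigma c = some n → n ∈ N)
    {m : RoleTerm V} (h : inst.apply m = some t) : t.nonces ⊆ N := by
  induction m generalizing t with
  | ident c =>
    rcases apply_ident_eq_some.1 h with ⟨h', rfl⟩ | ⟨-, n, hn, rfl⟩
    · simpa [RunTerm.nonces] using hc c h'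
    · simpa [RunTerm.nonces] using hs c n hn
  | role r =>
    obtain ⟨a, -, rfl⟩ := apply_role_eq_some.1 h
    simp [RunTerm.nonces]
  | func f n args ih =>
    obtain ⟨ts, hts, rfl⟩ := apply_func_eq_some.1 h
    exact Set.iUnion_subset fun i => ih i (hts i)
  | pair x y ihx ihy =>
    obtain ⟨u, v, hu, hv, rfl⟩ := apply_pair_eq_some.1 h
    exact Set.union_subset (ihx hu) (ihy hv)
  | enc x y ihx ihy =>
    obtain ⟨u, v, hu, hv, rfl⟩ := apply_enc_eq_some.1 h
    exact Set.union_subset (ihx hu) (ihy hv)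

theorem sigma_mem_nonces {c : V.Ident} {n : Nonce V} (hc : inst.typ c ≠ .const)
    (hn : inst.sigma c = some n) {m : RoleTerm V} (hm : c ∈ m.idents)
    (h : inst.apply m = some t) : n ∈ t.nonces := by
  induction m generalizing t with
  | ident c' =>
    obtain rfl : c = c' := hm
    rcases apply_ident_eq_some.1 h with ⟨h, -⟩ | ⟨-, n', hn', rfl⟩
    · exact absurd h hc
    · rw [hn] at hn'
      simpa [RunTerm.nonces] using hn'
  | role r => exact hm.elim
  | func f k args ih =>
    obtain ⟨ts, hts, rfl⟩ := apply_func_eq_some.1 h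
    obtain ⟨i, hi⟩ := Set.mem_iUnion.1 hm
    exact Set.mem_iUnion.2 ⟨i, ih i hi (hts i)⟩
  | pair x y ihx ihy =>
    obtain ⟨u, v, hu, hv, rfl⟩ := apply_pair_eq_some.1 h
    exact hm.imp (fun h => ihx h hu) fun h => ihy h hv
  | enc x y ihx ihy =>
    obtain ⟨u, v, hu, hv, rfl⟩ := apply_enc_eq_some.1 h
    exact hm.imp (fun h => ihx h hu) fun h => ihy h hv

/-- The instances under `inst` of the encryption subterms of `m`. -/
def encryptions (inst : Inst V) (m : RoleTerm V) : Set (RunTerm V) :=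
  {t | ∃ x y, Subterm (.enc x y) m ∧ inst.apply (.enc x y) = some t}

theorem encryptions_pair_left {x y : RoleTerm V} :
    inst.encryptions x ⊆ inst.encryptions (.pair x y) :=
  fun _ ⟨a, b, h, h'⟩ => ⟨a, b, .pair_left h, h'⟩

theorem encryptions_pair_right {x y : RoleTerm V} :
    inst.encryptions y ⊆ inst.encryptions (.pair x y) :=
  fun _ ⟨a, b, h, h'⟩ => ⟨a, b, .pair_right h, h'⟩

theorem encryptions_enc_body {x y : RoleTerm V} :
    inst.encryptions x ⊆ inst.encryptions (.enc x y) :=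
  fun _ ⟨a, b, h, h'⟩ => ⟨a, b, .enc_body h, h'⟩

theorem encryptions_enc_key {x y : RoleTerm V} :
    inst.encryptions y ⊆ inst.encryptions (.enc x y) :=
  fun _ ⟨a, b, h, h'⟩ => ⟨a, b, .enc_key h, h'⟩

theorem mem_encryptions_self {x y : RoleTerm V} (h : inst.apply (.enc x y) = some t) :
    t ∈ inst.encryptions (.enc x y) :=
  ⟨x, y, .refl _, h⟩

/-- The instances under `inst` of the encryptions that occur as content in `m`. -/
def sentEncryptions (inst : Inst V) (m : RoleTerm V) : Set (RunTerm V) :=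
  {t | ∃ x y, ContentOf (.enc x y) m ∧ inst.apply (.enc x y) = some t}

theorem sentEncryptions_subset {m : RoleTerm V} : inst.sentEncryptions m ⊆ inst.encryptions m :=
  fun _ ⟨a, b, h, h'⟩ => ⟨a, b, h.subterm, h'⟩

theorem sentEncryptions_mono {x m : RoleTerm V} (h : ContentOf x m) :
    inst.sentEncryptions x ⊆ inst.sentEncryptions m :=
  fun _ ⟨a, b, h₁, h₂⟩ => ⟨a, b, h₁.trans h, h₂⟩

theorem mem_sentEncryptions_self {x y : RoleTerm V} (h : inst.apply (.enc x y) = some t) :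
    t ∈ inst.sentEncryptions (.enc x y) :=
  ⟨x, y, .refl _, h⟩

/-- Only encryptions in `E` distinguish weakening from renaming. Arguments of functions are not
subterms, so independence does not control encryptions there; this is why `RunTerm.weaken` merely
renames inside function terms. -/
theorem weaken_eq_mapNonce (θ : Nonce V → Nonce V) {E : Set (RunTerm V)} (k : Nonce V)
    {m : RoleTerm V} (hE : Disjoint (inst.encryptions m) E) (h : inst.apply m = some t) :
    t.weaken θ E k = t.mapNonce θ := by
  induction m generalizing t with
  | ident c =>
    rcases apply_ident_eq_some.1 h with ⟨-, rfl⟩ | ⟨-, n, -, rfl⟩ <;> rfl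
  | role r =>
    obtain ⟨a, -, rfl⟩ := apply_role_eq_some.1 h
    rfl
  | func f n args ih =>
    obtain ⟨ts, -, rfl⟩ := apply_func_eq_some.1 h
    rfl
  | pair x y ihx ihy =>
    obtain ⟨u, v, hu, hv, rfl⟩ := apply_pair_eq_some.1 h
    rw [RunTerm.weaken, RunTerm.mapNonce, ihx (hE.mono_left encryptions_pair_left) hu,
      ihy (hE.mono_left encryptions_pair_right) hv]
  | enc x y ihx ihy =>
    have hn := hE.notMem_of_mem_left (mem_encryptions_self h)
    obtain ⟨u, v, hu, hv, rfl⟩ := apply_enc_eq_some.1 h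
    rw [RunTerm.weaken, if_neg hn, RunTerm.mapNonce, ihx (hE.mono_left encryptions_enc_body) hu,
      ihy (hE.mono_left encryptions_enc_key) hv]

theorem func_mem_initialKnowledge {m : RoleTerm V} (hm : ∀ x, ContentOf x m → ¬ IsSecretKey x)
    {f : V.Fn} {n : ℕ} {args : Fin n → RoleTerm V} (hf : ContentOf (.func f n args) m)
    (h : inst.apply (.func f n args) = some t) : t ∈ initialKnowledge V := by
  by_contra ht
  exact hm _ hf ⟨⟨f, n, args, rfl⟩, inst, t, h, ht⟩

/-- The weakened instance of a message is known as soon as the renamed nonces are. -/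
theorem weaken_mem_of_apply {θ : Nonce V → Nonce V} (hθ : ∀ y, θ (.intruder y) = .intruder y)
    {E M : Set (RunTerm V)} {x : V.IntruderAtom} (hM : IsClosedKnowledge M)
    (h₀ : initialKnowledge V ⊆ M)
    (hc : ∀ c, inst.typ c = .const → RunTerm.nonce (θ (.fresh c inst.rid)) ∈ M)
    (hs : ∀ c n, inst.sigma c = some n → RunTerm.nonce (θ n) ∈ M)
    {m : RoleTerm V} (hm : ∀ x, ContentOf x m → ¬ IsSecretKey x)
    (hE : inst.sentEncryptions m ⊆ E) (h : inst.apply m = some t) :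
    t.weaken θ E (.intruder x) ∈ M := by
  induction m generalizing t with
  | ident c =>
    rcases apply_ident_eq_some.1 h with ⟨h', rfl⟩ | ⟨-, n, hn, rfl⟩
    exacts [hc c h', hs c n hn]
  | role r =>
    obtain ⟨a, -, rfl⟩ := apply_role_eq_some.1 h
    exact h₀ (agent_mem_initialKnowledge a)
  | func f n args ih =>
    exact h₀ (weaken_mem_initialKnowledge hθ E x (func_mem_initialKnowledge hm (.refl _) h))
  | pair x y ihx ihy =>
    obtain ⟨u, v, hu, hv, rfl⟩ := apply_pair_eq_some.1 h
    exact hM _ (.pair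
      (.base (ihx (fun z hz => hm z (.pair_left hz))
        ((sentEncryptions_mono (.pair_left (.refl _))).trans hE) hu))
      (.base (ihy (fun z hz => hm z (.pair_right hz))
        ((sentEncryptions_mono (.pair_right (.refl _))).trans hE) hv)))
  | enc x y ihx ihy =>
    have he := hE (mem_sentEncryptions_self h)
    obtain ⟨u, v, hu, hv, rfl⟩ := apply_enc_eq_some.1 h
    -- The key has become the atom, so nothing need be known about the original key; only the body
    -- is treated recursively.
    rw [RunTerm.weaken, if_pos he]
    exact hM _ (.encrypt
      (.base (ihx (fun z hz => hm z (.enc_body hz))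
        ((sentEncryptions_mono (.enc_body (.refl _))).trans hE) hu))
      (.base (h₀ (intruder_mem_initialKnowledge _))))

end Inst

/-! ### Nonces outside the encryptions of a set -/

/-- All nonces of the term that occur outside the encryptions in `E` belong to `N`. -/
def Covered (N : Set (Nonce V)) (E : Set (RunTerm V)) : RunTerm V → Prop
  | .agent _ => True
  | .nonce n => n ∈ N
  | .func f n args => (RunTerm.func f n args).nonces ⊆ N
  | .pair t u => Covered N E t ∧ Covered N E u
  | .enc t u => .enc t u ∈ E ∨ Covered N E t ∧ Covered N E u

theorem Covered.mono {N N' : Set (Nonce V)} (hN : N ⊆ N') {E : Set (RunTerm V)} {t : RunTerm V}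
    (h : Covered N E t) : Covered N' E t := by
  induction t with
  | agent a => trivial
  | nonce n => exact hN h
  | func f n args ih => exact Set.Subset.trans h hN
  | pair t u iht ihu => exact ⟨iht h.1, ihu h.2⟩
  | enc t u iht ihu => exact h.imp_right fun h => ⟨iht h.1, ihu h.2⟩

theorem covered_of_nonces_subset {N : Set (Nonce V)} (E : Set (RunTerm V)) {t : RunTerm V}
    (h : t.nonces ⊆ N) : Covered N E t := by
  induction t with
  | agent a => trivial
  | nonce n => exact h rfl
  | func f n args ih => exact h
  | pair t u iht ihu =>
    exact ⟨iht (Set.subset_union_left.trans h), ihu (Set.subset_union_right.trans h)⟩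
  | enc t u iht ihu =>
    exact Or.inr ⟨iht (Set.subset_union_left.trans h), ihu (Set.subset_union_right.trans h)⟩

/-- An occurrence of a nonce can escape `Covered` only inside an encryption from `E`, and an
instance of `m` offers none. Function terms are covered as a whole, so their arguments provide no
hiding place either. -/
theorem nonces_subset_of_covered {N : Set (Nonce V)} {E : Set (RunTerm V)} {inst : Inst V}
    {m : RoleTerm V} {t : RunTerm V} (hE : Disjoint (inst.encryptions m) E)
    (h : inst.apply m = some t) (ht : Covered N E t) : t.nonces ⊆ N := by
  induction m generalizing t with
  | ident c =>
    rcases Inst.apply_ident_eq_some.1 h with ⟨-, rfl⟩ | ⟨-, n, -, rfl⟩ <;>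
      exact Set.singleton_subset_iff.2 ht
  | role r =>
    obtain ⟨a, -, rfl⟩ := Inst.apply_role_eq_some.1 h
    exact Set.empty_subset _
  | func f n args ih =>
    obtain ⟨ts, -, rfl⟩ := Inst.apply_func_eq_some.1 h
    exact ht
  | pair x y ihx ihy =>
    obtain ⟨u, v, hu, hv, rfl⟩ := Inst.apply_pair_eq_some.1 h
    exact Set.union_subset (ihx (hE.mono_left Inst.encryptions_pair_left) hu ht.1)
      (ihy (hE.mono_left Inst.encryptions_pair_right) hv ht.2)
  | enc x y ihx ihy =>
    have hn := hE.notMem_of_mem_left (Inst.mem_encryptions_self h)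
    obtain ⟨u, v, hu, hv, rfl⟩ := Inst.apply_enc_eq_some.1 h
    have ht := Or.resolve_left ht hn
    exact Set.union_subset (ihx (hE.mono_left Inst.encryptions_enc_body) hu ht.1)
      (ihy (hE.mono_left Inst.encryptions_enc_key) hv ht.2)

/-- A known message whose encryptions lie in `E` is covered by the known nonces. -/
theorem covered_of_apply_mem {N : Set (Nonce V)} {E M : Set (RunTerm V)}
    (hM : IsClosedKnowledge M) (hN : ∀ n, RunTerm.nonce n ∈ M → n ∈ N)
    (hN₀ : ∀ x, Nonce.intruder x ∈ N) {inst : Inst V} {m : RoleTerm V} {t : RunTerm V}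
    (hm : ∀ x, ContentOf x m → ¬ IsSecretKey x) (hE : inst.sentEncryptions m ⊆ E)
    (h : inst.apply m = some t) (ht : t ∈ M) : Covered N E t := by
  induction m generalizing t with
  | ident c =>
    rcases Inst.apply_ident_eq_some.1 h with ⟨-, rfl⟩ | ⟨-, n, -, rfl⟩ <;> exact hN _ ht
  | role r =>
    obtain ⟨a, -, rfl⟩ := Inst.apply_role_eq_some.1 h
    trivial
  | func f n args ih =>
    refine covered_of_nonces_subset E fun k hk => ?_
    obtain ⟨x, rfl⟩ := exists_intruder_of_mem_initialKnowledge
      (Inst.func_mem_initialKnowledge hm (.refl _) h) k hk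
    exact hN₀ x
  | pair x y ihx ihy =>
    obtain ⟨u, v, hu, hv, rfl⟩ := Inst.apply_pair_eq_some.1 h
    exact ⟨ihx (fun z hz => hm z (.pair_left hz))
        ((Inst.sentEncryptions_mono (.pair_left (.refl _))).trans hE) hu
        (hM _ (.fst (.base ht))),
      ihy (fun z hz => hm z (.pair_right hz))
        ((Inst.sentEncryptions_mono (.pair_right (.refl _))).trans hE) hv
        (hM _ (.snd (.base ht)))⟩
  | enc x y ihx ihy =>
    have he := hE (Inst.mem_sentEncryptions_self h)
    obtain ⟨u, v, hu, hv, rfl⟩ := Inst.apply_enc_eq_some.1 h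
    exact Or.inl he

/-- If the encryptions in `E` are instances of parts of messages, coverage by the known nonces is
inherited by the derivable terms. -/
theorem covered_of_derivable {N : Set (Nonce V)} {E M S : Set (RunTerm V)}
    (hM : IsClosedKnowledge M) (hS : S ⊆ M) (hN : ∀ n, RunTerm.nonce n ∈ M → n ∈ N)
    (hN₀ : ∀ x, Nonce.intruder x ∈ N)
    (hE : ∀ t ∈ E, ∃ (inst : Inst V) (x y : RoleTerm V), inst.apply (.enc x y) = some t ∧
      (∀ z, ContentOf z x → ¬ IsSecretKey z) ∧ inst.sentEncryptions x ⊆ E)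
    (hcov : ∀ t ∈ S, Covered N E t) {t : RunTerm V} (h : Derivable S t) :
    t ∈ M ∧ Covered N E t := by
  induction h with
  | base h => exact ⟨hS h, hcov _ h⟩
  | pair _ _ h₁ h₂ => exact ⟨hM _ (.pair (.base h₁.1) (.base h₂.1)), h₁.2, h₂.2⟩
  | fst _ h => exact ⟨hM _ (.fst (.base h.1)), h.2.1⟩
  | snd _ h => exact ⟨hM _ (.snd (.base h.1)), h.2.2⟩
  | encrypt _ _ h₁ h₂ => exact ⟨hM _ (.encrypt (.base h₁.1) (.base h₂.1)), Or.inr ⟨h₁.2, h₂.2⟩⟩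
  | decrypt _ _ h₁ h₂ =>
    have ht := hM _ (.decrypt (.base h₁.1) (.base h₂.1))
    refine ⟨ht, ?_⟩
    rcases h₁.2 with he | h
    -- Opening an encryption from `E` exposes a body that was not covered before. But this body is
    -- now known, so its exposed nonces are known too, and its content encryptions lie in `E` again.
    · obtain ⟨inst, x, y, ha, hx, hxE⟩ := hE _ he
      obtain ⟨u, v, hu, -, heq⟩ := Inst.apply_enc_eq_some.1 ha
      obtain ⟨rfl, rfl⟩ := RunTerm.enc.inj heq
      exact covered_of_apply_mem hM hN hN₀ hx hxE hu ht
    · exact h.1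

/-! ### Runs and knowledge along a trace -/

/-- A step either creates a run or executes the next event of an active run. -/
theorem Step.create_or_advance {S : Set (Protocol V)} {st st' : State V} {e : RunEvent V}
    (h : Step S st e st') :
    (∃ l r rest, e.ev = .create l r ∧ ⟨e.inst, .create l r :: rest⟩ ∈ initialRuns S ∧
      (∀ run ∈ st.runs, run.inst.rid ≠ e.inst.rid) ∧ st'.runs = st.runs ∪ {⟨e.inst, rest⟩}) ∨
    ∃ run ∈ st.runs, ∃ rest, run.rest = e.ev :: rest ∧ e.inst.rid = run.inst.rid ∧
      e.inst.typ = run.inst.typ ∧ (∀ l r, e.ev ≠ .create l r) ∧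
      st'.runs = replaceRun st.runs ⟨e.inst, rest⟩ run := by
  cases h with
  | create h₁ h₂ => exact Or.inl ⟨_, _, _, rfl, h₁, h₂, rfl⟩
  | finish h => exact Or.inr ⟨_, h, _, rfl, rfl, rfl, by simp, rfl⟩
  | send h _ => exact Or.inr ⟨_, h, _, rfl, rfl, rfl, by simp, rfl⟩
  | read h _ hm => exact Or.inr ⟨_, h, _, rfl, hm.1, hm.2.1, by simp, rfl⟩
  | claim h => exact Or.inr ⟨_, h, _, rfl, rfl, rfl, by simp, rfl⟩

theorem Step.know_subset {S : Set (Protocol V)} {st st' : State V} {e : RunEvent V}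
    (h : Step S st e st') : st.know ⊆ st'.know := by
  cases h with
  | send _ _ => exact Set.subset_union_left.trans (subset_closure _)
  | _ => exact subset_rfl

/-- A send event records its instantiation, so the event alone determines the term that is added;
the active runs need not be compared. -/
theorem Step.know_eq {S : Set (Protocol V)} {st₁ st₁' st₂ st₂' : State V} {e : RunEvent V}
    (h₁ : Step S st₁ e st₁') (h₂ : Step S st₂ e st₂') (h : st₁.know = st₂.know) :
    st₁'.know = st₂'.know := by
  cases h₁ <;> cases h₂
  case send.send ha _ _ _ _ hb _ =>
    obtain rfl := Option.some.inj (ha.symm.trans hb)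
    exact congrArg (fun M => closure (M ∪ {_})) h
  all_goals exact h

theorem Reaches.isClosedKnowledge {S : Set (Protocol V)} {α : Trace V} {st : State V}
    (h : Reaches S α st) : IsClosedKnowledge st.know := by
  induction h with
  | nil => exact isClosedKnowledge_closure _
  | snoc _ h ih =>
    cases h with
    | send _ _ => exact isClosedKnowledge_closure _
    | _ => exact ih

theorem Reaches.initialKnowledge_subset {S : Set (Protocol V)} {α : Trace V} {st : State V}
    (h : Reaches S α st) : initialKnowledge V ⊆ st.know := by
  induction h with
  | nil => exact subset_rfl
  | snoc _ h ih => exact ih.trans h.know_subset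

theorem Reaches.know_eq {S : Set (Protocol V)} {α : Trace V} {st₁ st₂ : State V}
    (h₁ : Reaches S α st₁) (h₂ : Reaches S α st₂) : st₁.know = st₂.know := by
  induction h₁ generalizing st₂ with
  | nil =>
    generalize hα : ([] : Trace V) = β at h₂
    cases h₂ with
    | nil => rfl
    | snoc => simp at hα
  | @snoc α st e st' _ h ih =>
    generalize hα : α ++ [e] = β at h₂
    cases h₂ with
    | nil => simp at hα
    | snoc h₂ h' =>
      obtain ⟨rfl, he⟩ := List.append_inj' hα rfl
      obtain rfl := (List.cons.inj he).1
      exact h.know_eq h' (ih h₂)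

theorem Reaches.knowledgeAt_eq {S : Set (Protocol V)} {α : Trace V} {i : ℕ} {st : State V}
    (h : Reaches S (α.take i) st) : knowledgeAt S α i = st.know := by
  ext t
  exact ⟨fun ⟨_, h', ht⟩ => h'.know_eq h ▸ ht, fun ht => ⟨st, h, ht⟩⟩

/-- The run was created in `α` from a role of a protocol of `S`, whose event list contains the
remaining events of the run. -/
def HasOrigin (S : Set (Protocol V)) (α : Trace V) (run : Run V) : Prop :=
  ∃ P ∈ S, ∃ r rs inst l r', P r = some rs ∧ ⟨inst, .create l r'⟩ ∈ α ∧
    .create l r' ∈ rs.elist ∧ inst.rid = run.inst.rid ∧ inst.typ = run.inst.typ ∧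
    ∀ e ∈ run.rest, e ∈ rs.elist

theorem HasOrigin.mono {S : Set (Protocol V)} {α β : Trace V} {run : Run V}
    (h : HasOrigin S α run) (hα : ∀ e ∈ α, e ∈ β) : HasOrigin S β run := by
  obtain ⟨P, hP, r, rs, inst, l, r', hr, h, h'⟩ := h
  exact ⟨P, hP, r, rs, inst, l, r', hr, hα _ h, h'⟩

theorem HasOrigin.advance {S : Set (Protocol V)} {α : Trace V} {run run' : Run V}
    (h : HasOrigin S α run) (hrid : run'.inst.rid = run.inst.rid)
    (htyp : run'.inst.typ = run.inst.typ) (hrest : ∀ e ∈ run'.rest, e ∈ run.rest) :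
    HasOrigin S α run' := by
  obtain ⟨P, hP, r, rs, inst, l, r', hr, h, h', h₁, h₂, h₃⟩ := h
  exact ⟨P, hP, r, rs, inst, l, r', hr, h, h', h₁.trans hrid.symm, h₂.trans htyp.symm,
    fun e he => h₃ e (hrest e he)⟩

theorem HasOrigin.labelIn {S : Set (Protocol V)} {α : Trace V} {run : Run V}
    (h : HasOrigin S α run) {e : Event V} (he : e ∈ run.rest) : LabelIn S e.label := by
  obtain ⟨P, hP, r, rs, -, -, -, hr, -, -, -, -, h⟩ := h
  exact ⟨P, hP, r, rs, e, hr, h e he, rfl⟩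

theorem HasOrigin.of_union {S₁ S₂ : Set (Protocol V)} {α : Trace V} {run : Run V}
    (h : HasOrigin (S₁ ∪ S₂) α run) : HasOrigin S₁ α run ∨ HasOrigin S₂ α run := by
  obtain ⟨P, hP, h⟩ := h
  exact hP.imp (fun hP => ⟨P, hP, h⟩) fun hP => ⟨P, hP, h⟩

/-- The runs that are created in `α` for a role of `S`. -/
def createdRids (S : Set (Protocol V)) (α : Trace V) : Set V.RunId :=
  {rid | ∃ inst l r, ⟨inst, .create l r⟩ ∈ α ∧ LabelIn S l ∧ inst.rid = rid}

theorem HasOrigin.mem_createdRids {S : Set (Protocol V)} {α : Trace V} {run : Run V}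
    (h : HasOrigin S α run) : run.inst.rid ∈ createdRids S α := by
  obtain ⟨P, hP, r, rs, inst, l, r', hr, h, h', h₁, -⟩ := h
  exact ⟨inst, l, r', h, ⟨P, hP, r, rs, _, hr, h', rfl⟩, h₁⟩

/-- Active runs and the events of the trace have an origin in the trace, and run identifiers
are unique. -/
theorem Reaches.runs {S : Set (Protocol V)} {α : Trace V} {st : State V} (h : Reaches S α st) :
    (∀ run ∈ st.runs, HasOrigin S α run) ∧
    (∀ e ∈ α, HasOrigin S α ⟨e.inst, [e.ev]⟩) ∧
    (∀ run ∈ st.runs, ∀ run' ∈ st.runs, run.inst.rid = run'.inst.rid → run = run') ∧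
    (∀ inst l r, ⟨inst, .create l r⟩ ∈ α → ∃ run ∈ st.runs, run.inst.rid = inst.rid) ∧
    (∀ inst l r inst' l' r', ⟨inst, .create l r⟩ ∈ α → ⟨inst', .create l' r'⟩ ∈ α →
      inst.rid = inst'.rid → inst = inst' ∧ l = l') := by
  induction h with
  | nil => simp
  | @snoc α st e st' _ h ih =>
    obtain ⟨h₁, h₂, h₃, h₄, h₅⟩ := ih
    have hα : ∀ e' ∈ α, e' ∈ α ++ [e] := fun e' => List.mem_append_left _
    rcases h.create_or_advance with ⟨l, r, rest, he, hinit, hnew, hruns⟩ |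
      ⟨run, hrun, rest, hrest, hrid, htyp, hne, hruns⟩
    · obtain ⟨inst, ev⟩ := e
      obtain rfl : ev = _ := he
      have horig : HasOrigin S (α ++ [⟨inst, .create l r⟩]) ⟨inst, .create l r :: rest⟩ := by
        obtain ⟨P, hP, r', rs, hr, h₁, h₂, -⟩ := hinit
        have h₁ : Event.create l r :: rest = rs.elist := h₁
        exact ⟨P, hP, r', rs, inst, l, r, hr, by simp, by simp [← h₁], rfl, rfl, by simp [← h₁]⟩
      rw [hruns]
      refine ⟨?_, ?_, ?_, ?_, ?_⟩
      · rintro run (hrun | rfl)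
        · exact (h₁ run hrun).mono hα
        · exact horig.advance rfl rfl fun e he => List.mem_cons_of_mem _ he
      · intro e he
        rcases List.mem_append.1 he with he | he
        · exact (h₂ e he).mono hα
        · obtain rfl := List.mem_singleton.1 he
          exact horig.advance rfl rfl (by simp)
      · rintro run (hrun | rfl) run' (hrun' | rfl) heq
        · exact h₃ run hrun run' hrun' heq
        · exact absurd heq (hnew run hrun)
        · exact absurd heq.symm (hnew run' hrun')
        · rfl
      · intro inst' l' r' he
        rcases List.mem_append.1 he with he | he
        · obtain ⟨run, hrun, h⟩ := h₄ _ _ _ he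
          exact ⟨run, Or.inl hrun, h⟩
        · simp only [List.mem_singleton, RunEvent.mk.injEq] at he
          exact ⟨_, Or.inr rfl, by rw [he.1]⟩
      · intro inst₁ l₁ r₁ inst₂ l₂ r₂ he₁ he₂ heq
        simp only [List.mem_append, List.mem_singleton, RunEvent.mk.injEq,
          Event.create.injEq] at he₁ he₂
        rcases he₁ with he₁ | ⟨rfl, rfl, rfl⟩ <;> rcases he₂ with he₂ | ⟨rfl, rfl, rfl⟩
        · exact h₅ _ _ _ _ _ _ he₁ he₂ heq
        · obtain ⟨run, hrun, h⟩ := h₄ _ _ _ he₁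
          exact absurd (h.trans heq) (hnew run hrun)
        · obtain ⟨run, hrun, h⟩ := h₄ _ _ _ he₂
          exact absurd (h.trans heq.symm) (hnew run hrun)
        · exact ⟨rfl, rfl⟩
    · have hcreate : ∀ inst l r, ⟨inst, .create l r⟩ ∈ α ++ [e] → ⟨inst, .create l r⟩ ∈ α := by
        intro inst l r he
        rcases List.mem_append.1 he with he | he
        · exact he
        · exact absurd (congrArg RunEvent.ev (List.mem_singleton.1 he)).symm (hne l r)
      rw [hruns]
      refine ⟨?_, ?_, ?_, ?_, ?_⟩
      · rintro run' (rfl | hrun')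
        · exact ((h₁ run hrun).mono hα).advance hrid htyp (by simp +contextual [hrest])
        · exact (h₁ run' hrun'.1).mono hα
      · intro e' he
        rcases List.mem_append.1 he with he | he
        · exact (h₂ e' he).mono hα
        · obtain rfl := List.mem_singleton.1 he
          exact ((h₁ run hrun).mono hα).advance hrid htyp (by simp [hrest])
      · rintro run₁ (rfl | hrun₁) run₂ (rfl | hrun₂) heq
        · rfl
        · exact absurd (h₃ run₂ hrun₂.1 run hrun (heq.symm.trans hrid)) hrun₂.2
        · exact absurd (h₃ run₁ hrun₁.1 run hrun (heq.trans hrid)) hrun₁.2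
        · exact h₃ run₁ hrun₁.1 run₂ hrun₂.1 heq
      · intro inst l r he
        obtain ⟨run', hrun', h⟩ := h₄ _ _ _ (hcreate _ _ _ he)
        by_cases heq : run' = run
        · exact ⟨_, Or.inl rfl, by rw [← h, heq, ← hrid]⟩
        · exact ⟨run', Or.inr ⟨hrun', heq⟩, h⟩
      · exact fun inst l r inst' l' r' he he' =>
          h₅ _ _ _ _ _ _ (hcreate _ _ _ he) (hcreate _ _ _ he')

/-! ### Traces of a union of two independent protocol sets -/

/-- The assumptions on a trace `α` of `S₁ ∪ S₂` under which its part in `S₁` can be simulated by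
`S₁` alone. -/
structure Separated (S₁ S₂ : Set (Protocol V)) (α : Trace V) : Prop where
  labels : ∀ l, LabelIn S₁ l → ¬ LabelIn S₂ l
  keys : ∀ P ∈ S₁ ∪ S₂, P.SecretKeysOnlyAsKeys
  valid : α ∈ traces (S₁ ∪ S₂)
  input : NoPrivateInput S₁ S₂ α
  encryptions : ∀ e ∈ α, ∀ e' ∈ α, ∀ m m', e.ev.Sends m → e'.ev.Mentions m' →
    ¬ Disjoint (e.inst.encryptions m) (e'.inst.encryptions m') →
    (LabelIn S₁ e.ev.label ∧ LabelIn S₁ e'.ev.label) ∨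
      (LabelIn S₂ e.ev.label ∧ LabelIn S₂ e'.ev.label)

/-- The encryptions that occur as content in messages sent in `α` by runs of `S`. -/
def sentEncryptionsOf (S : Set (Protocol V)) (α : Trace V) : Set (RunTerm V) :=
  {t | ∃ e ∈ α, LabelIn S e.ev.label ∧ ∃ m, e.ev.Sends m ∧ t ∈ e.inst.sentEncryptions m}

theorem IsProtocolSet.not_labelIn {S₁ S₂ : Set (Protocol V)} (h : IsProtocolSet (S₁ ∪ S₂))
    (hd : Disjoint S₁ S₂) {l : V.Label} (h₁ : LabelIn S₁ l) : ¬ LabelIn S₂ l := by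
  rintro ⟨Q, hQ, hQl⟩
  obtain ⟨P, hP, hPl⟩ := h₁
  obtain rfl := h.2 P (Or.inl hP) Q (Or.inr hQ) l hPl hQl
  exact hd.notMem_of_mem_left hP hQ

theorem Independent.separated {S₁ S₂ : Set (Protocol V)} {χ : Trace V → Prop}
    (hind : Independent χ S₁ S₂) (hset : IsProtocolSet (S₁ ∪ S₂))
    (hkeys : ∀ P ∈ S₁ ∪ S₂, P.SecretKeysOnlyAsKeys) {α : Trace V} (hα : α ∈ traces (S₁ ∪ S₂))
    (hχ : χ α) (hinput : NoPrivateInput S₁ S₂ α) : Separated S₁ S₂ α where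
  labels _ := hset.not_labelIn hind.1
  keys := hkeys
  valid := hα
  input := hinput
  encryptions e he e' he' m m' hm hm' h := by
    obtain ⟨t, ⟨x, y, hs, ht⟩, x', y', hs', ht'⟩ := Set.not_disjoint_iff.1 h
    exact hind.2 α hα hχ e he e' he' m m' x y x' y' t hm hm' hs hs' ht ht'

theorem HasOrigin.not_isSecretKey {S : Set (Protocol V)} {α : Trace V} {run : Run V}
    (h : HasOrigin S α run) (hkeys : ∀ P ∈ S, P.SecretKeysOnlyAsKeys) {l : V.Label}
    {s s' : V.Role} {m : RoleTerm V}
    (hm : .send l s s' m ∈ run.rest) : ∀ x, ContentOf x m → ¬ IsSecretKey x := by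
  obtain ⟨P, hP, r, rs, inst, l', r', hr, -, -, -, -, h⟩ := h
  exact hkeys P hP r rs hr l s s' m (Or.inl (h _ hm))

/-! ### Separating the runs, events and encryptions of the two protocol sets -/

namespace Separated

variable {S₁ S₂ : Set (Protocol V)} {α : Trace V}

theorem hasOrigin (h : Separated S₁ S₂ α)
    {e : RunEvent V} (he : e ∈ α) : HasOrigin (S₁ ∪ S₂) α ⟨e.inst, [e.ev]⟩ := by
  obtain ⟨st, hst⟩ := h.valid
  exact hst.runs.2.1 e he

theorem disjoint_createdRids (h : Separated S₁ S₂ α) :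
    Disjoint (createdRids S₁ α) (createdRids S₂ α) := by
  rw [Set.disjoint_left]
  rintro rid ⟨inst, l, r, he, hl, rfl⟩ ⟨inst', l', r', he', hl', heq⟩
  obtain ⟨st, hst⟩ := h.valid
  obtain ⟨-, rfl⟩ := hst.runs.2.2.2.2 _ _ _ _ _ _ he he' heq.symm
  exact h.labels _ hl hl'

theorem hasOrigin_left (h : Separated S₁ S₂ α) {run : Run V} (hrun : HasOrigin (S₁ ∪ S₂) α run)
    (hrid : run.inst.rid ∈ createdRids S₁ α) : HasOrigin S₁ α run :=
  hrun.of_union.resolve_right fun h' =>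
    h.disjoint_createdRids.notMem_of_mem_left hrid h'.mem_createdRids

theorem hasOrigin_right (h : Separated S₁ S₂ α) {run : Run V} (hrun : HasOrigin (S₁ ∪ S₂) α run)
    (hrid : run.inst.rid ∈ createdRids S₂ α) : HasOrigin S₂ α run :=
  hrun.of_union.resolve_left fun h' =>
    h.disjoint_createdRids.notMem_of_mem_right hrid h'.mem_createdRids

theorem mem_createdRids (h : Separated S₁ S₂ α) {e : RunEvent V} (he : e ∈ α) :
    (LabelIn S₁ e.ev.label ∧ e.inst.rid ∈ createdRids S₁ α) ∨
      (LabelIn S₂ e.ev.label ∧ e.inst.rid ∈ createdRids S₂ α) :=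
  (h.hasOrigin he).of_union.imp
    (fun h' => ⟨h'.labelIn (List.mem_singleton_self _), h'.mem_createdRids⟩)
    (fun h' => ⟨h'.labelIn (List.mem_singleton_self _), h'.mem_createdRids⟩)

theorem labelIn_right (h : Separated S₁ S₂ α)
    {e : RunEvent V} (he : e ∈ α) (hrid : e.inst.rid ∈ createdRids S₂ α) :
    LabelIn S₂ e.ev.label :=
  (h.hasOrigin_right (h.hasOrigin he) hrid).labelIn (List.mem_singleton_self _)

theorem generatedBy_fresh (h : Separated S₁ S₂ α)
    {inst : Inst V} {ev : Event V} (he : ⟨inst, ev⟩ ∈ α)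
    (hrid : inst.rid ∈ createdRids S₁ α) {c : V.Ident} (hc : inst.typ c = .const) :
    GeneratedBy S₁ α (.fresh c inst.rid) := by
  obtain ⟨P, hP, r, rs, inst', l, r', hr, hmem, hl, h₁, h₂, -⟩ :=
    h.hasOrigin_left (h.hasOrigin he) hrid
  exact ⟨inst', l, r', c, hmem, ⟨P, hP, r, rs, _, hr, hl, rfl⟩, by rw [h₂]; exact hc,
    by rw [h₁]⟩

theorem not_generatedBy_fresh (h : Separated S₁ S₂ α)
    {rid : V.RunId} (hrid : rid ∈ createdRids S₂ α) (c : V.Ident) :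
    ¬ GeneratedBy S₁ α (.fresh c rid) := by
  rintro ⟨inst, l, r, c', he, hl, -, heq⟩
  obtain ⟨-, rfl⟩ := Nonce.fresh.inj heq
  exact h.disjoint_createdRids.notMem_of_mem_right hrid ⟨inst, l, r, he, hl, rfl⟩

/-- Independence compares a send with a send, read or claim, so it applies with the send taken from
`S₂` and any mention from `S₁`. This is what shields `S₁` from weakening. -/
theorem disjoint_left (h : Separated S₁ S₂ α)
    {e : RunEvent V} (he : e ∈ α) (hl : LabelIn S₁ e.ev.label)
    {m : RoleTerm V} (hm : e.ev.Mentions m) :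
    Disjoint (e.inst.encryptions m) (sentEncryptionsOf S₂ α) := by
  rw [Set.disjoint_left]
  rintro t ht ⟨e', he', hl', m', hm', ht'⟩
  rcases h.encryptions e' he' e he m' m hm' hm
    (Set.not_disjoint_iff.2 ⟨t, Inst.sentEncryptions_subset ht', ht⟩) with h' | h'
  exacts [h.labels _ h'.1 hl', h.labels _ hl h'.2]

/-- The mirror case is used for reads of `S₂`: no nonce can reach `S₂` inside an encryption sent by
`S₁`. -/
theorem disjoint_right (h : Separated S₁ S₂ α)
    {e : RunEvent V} (he : e ∈ α) (hl : LabelIn S₂ e.ev.label)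
    {m : RoleTerm V} (hm : e.ev.Mentions m) :
    Disjoint (e.inst.encryptions m) (sentEncryptionsOf S₁ α) := by
  rw [Set.disjoint_left]
  rintro t ht ⟨e', he', hl', m', hm', ht'⟩
  rcases h.encryptions e' he' e he m' m hm' hm
    (Set.not_disjoint_iff.2 ⟨t, Inst.sentEncryptions_subset ht', ht⟩) with h' | h'
  exacts [h.labels _ h'.2 hl, h.labels _ hl' h'.1]

theorem not_isSecretKey (h : Separated S₁ S₂ α)
    {e : RunEvent V} (he : e ∈ α) {m : RoleTerm V} (hm : e.ev.Sends m) :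
    ∀ x, ContentOf x m → ¬ IsSecretKey x := by
  obtain ⟨l, s, s', hm⟩ := hm
  exact (h.hasOrigin he).not_isSecretKey h.keys (l := l) (s := s) (s' := s')
    (by simp [hm])

end Separated

/-- The nonces that are not generated by runs of `S` or that belong to `M`. -/
def publicNonces (S : Set (Protocol V)) (α : Trace V) (M : Set (RunTerm V)) : Set (Nonce V) :=
  {n | GeneratedBy S α n → RunTerm.nonce n ∈ M}

theorem publicNonces_mono (S : Set (Protocol V)) (α : Trace V) {M M' : Set (RunTerm V)}
    (h : M ⊆ M') : publicNonces S α M ⊆ publicNonces S α M' :=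
  fun _ hn hg => h (hn hg)

theorem not_generatedBy_intruder (S : Set (Protocol V)) (α : Trace V) (x : V.IntruderAtom) :
    ¬ GeneratedBy S α (.intruder x) := by
  rintro ⟨_, _, _, _, _, _, _, h⟩
  cases h

/-- The body of a content encryption is again content, so it contains no secret key as content.
Collecting only content encryptions matters: an encryption inside a key may have a secret key in its
body. -/
theorem Separated.covered_of_derivable {S₁ S₂ : Set (Protocol V)} {α : Trace V}
    (h : Separated S₁ S₂ α) {M S : Set (RunTerm V)} (hM : IsClosedKnowledge M) (hS : S ⊆ M)
    (hcov : ∀ t ∈ S, Covered (publicNonces S₁ α M) (sentEncryptionsOf S₁ α) t) {t : RunTerm V}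
    (ht : Derivable S t) : Covered (publicNonces S₁ α M) (sentEncryptionsOf S₁ α) t := by
  refine (SecProt.covered_of_derivable (N := publicNonces S₁ α M) hM hS (fun n hn _ => hn)
    (fun x hx => absurd hx (not_generatedBy_intruder _ _ _)) ?_ hcov ht).2
  rintro t ⟨e, he, hl, m, hm, x, y, hxy, ht⟩
  have hx : ContentOf x m := (ContentOf.enc_body (.refl x)).trans hxy
  exact ⟨e.inst, x, y, ht, fun z hz => h.not_isSecretKey he hm z (hz.trans hx),
    fun s hs => ⟨e, he, hl, m, hm, Inst.sentEncryptions_mono hx hs⟩⟩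

/-- The intruder knows every nonce generated by a run of `S₁` that is held by a run of `S₂`. -/
theorem Separated.sigma_mem_publicNonces {S₁ S₂ : Set (Protocol V)} {α : Trace V}
    (h : Separated S₁ S₂ α) {β : Trace V} {st : State V} (hst : Reaches (S₁ ∪ S₂) β st)
    (hβ : β <+: α) :
    (∀ t ∈ st.know, Covered (publicNonces S₁ α st.know) (sentEncryptionsOf S₁ α) t) ∧
    ∀ run ∈ st.runs, run.inst.rid ∈ createdRids S₂ α →
      ∀ c n, run.inst.sigma c = some n → n ∈ publicNonces S₁ α st.know := by
  induction hst with
  | nil =>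
    refine ⟨fun t ht => covered_of_nonces_subset _ fun n hn hg => ?_, by simp⟩
    obtain ⟨x, rfl⟩ := exists_intruder_of_mem_initialKnowledge ht n hn
    exact absurd hg (not_generatedBy_intruder _ _ _)
  | @snoc β st e st' hst hstep ih =>
    have hβα : β <+: α := (List.prefix_append _ _).trans hβ
    have heα : e ∈ α := hβ.subset (by simp)
    obtain ⟨ih₁, ih₂⟩ := ih hβα
    cases hstep with
    | @create M F inst l r rest hinit hnew =>
      refine ⟨ih₁, ?_⟩
      rintro run (hrun | rfl) hrid c n hn
      · exact ih₂ run hrun hrid c n hn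
      · intro hg
        -- The create event has index `β.length` in `α`, so the input restriction speaks of the
        -- knowledge just before it, which is `M`.
        obtain ⟨γ, rfl⟩ := hβ
        have := h.input β.length inst l r (by simp) (h.labelIn_right heα hrid) c n hn hg
        have htake :
            (β ++ [(⟨inst, .create l r⟩ : RunEvent V)] ++ γ).take β.length = β := by simp
        rw [Reaches.knowledgeAt_eq (st := ⟨M, F⟩) (htake.symm ▸ hst)] at this
        exact this
    | @finish M F inst l r hrun =>
      refine ⟨ih₁, ?_⟩
      rintro run (rfl | hrun') hrid c n hn
      · exact ih₂ _ hrun hrid c n hn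
      · exact ih₂ _ hrun'.1 hrid c n hn
    | @claim M F inst l r cl m rest hrun =>
      refine ⟨ih₁, ?_⟩
      rintro run (rfl | hrun') hrid c n hn
      · exact ih₂ _ hrun hrid c n hn
      · exact ih₂ _ hrun'.1 hrid c n hn
    | @read M F inst l s s' m rest t inst' hrun ht hm =>
      refine ⟨ih₁, ?_⟩
      rintro run (rfl | hrun') hrid c n hn
      · obtain ⟨hmrid, hmtyp, -, hold, hdom, happ⟩ := hm
        rcases (hdom c).1 (Option.isSome_iff_exists.2 ⟨n, hn⟩) with hc | ⟨hc, hvar⟩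
        · obtain ⟨k, hk⟩ := Option.isSome_iff_exists.1 hc
          obtain rfl := Option.some.inj ((hold c k hk).symm.trans hn)
          exact ih₂ _ hrun (hmrid ▸ hrid) c k hk
        -- A newly assigned variable occurs in `m`, so its value occurs in the known term `t`; by
        -- independence no encryption of `S₁` conceals it there.
        · exact nonces_subset_of_covered
            (h.disjoint_right heα (h.labelIn_right heα hrid) (Or.inl ⟨l, s, s', rfl⟩)) happ
            (ih₁ t ht) (Inst.sigma_mem_nonces (by rw [hmtyp, hvar]; simp) hn hc happ)
      · exact ih₂ _ hrun'.1 hrid c n hn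
    | @send M F inst l s s' m rest t hrun ht =>
      have hM : M ⊆ closure (M ∪ {t}) := Set.subset_union_left.trans (subset_closure _)
      refine ⟨fun u hu => h.covered_of_derivable (isClosedKnowledge_closure _)
        (subset_closure _) ?_ hu, ?_⟩
      · rintro u (hu | rfl)
        · exact (ih₁ u hu).mono (publicNonces_mono _ _ hM)
        -- A message of `S₁` is covered because sending it makes its exposed nonces known. In a
        -- message of `S₂` every nonce is a constant of that run, hence not generated by `S₁`, or a
        -- held value, public by induction.
        · rcases h.mem_createdRids heα with ⟨hl, hrid⟩ | ⟨hl, hrid⟩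
          · exact covered_of_apply_mem (N := publicNonces S₁ α (closure (M ∪ {u})))
              (E := sentEncryptionsOf S₁ α) (isClosedKnowledge_closure _) (fun n hn _ => hn)
              (fun x hx => absurd hx (not_generatedBy_intruder _ _ _))
              (h.not_isSecretKey heα ⟨l, s, s', rfl⟩)
              (fun v hv => ⟨_, heα, hl, m, ⟨l, s, s', rfl⟩, hv⟩) ht
              (subset_closure _ (Or.inr rfl))
          · exact covered_of_nonces_subset _ (Inst.nonces_subset_of_apply
              (fun c _ hg => absurd hg (h.not_generatedBy_fresh hrid c))
              (fun c n hn => publicNonces_mono _ _ hM (ih₂ _ hrun hrid c n hn)) ht)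
      · rintro run (rfl | hrun') hrid c n hn
        · exact publicNonces_mono _ _ hM (ih₂ _ hrun hrid c n hn)
        · exact publicNonces_mono _ _ hM (ih₂ _ hrun'.1 hrid c n hn)

/-! ### Simulation of the runs of one protocol set -/

open Classical in
/-- Replace the nonces that are not generated by runs of `S` in `α` by an intruder term. -/
noncomputable def hideNonce (S : Set (Protocol V)) (α : Trace V) (x : V.IntruderAtom) :
    Nonce V → Nonce V
  | .fresh c rid => if GeneratedBy S α (.fresh c rid) then .fresh c rid else .intruder x
  | .intruder y => .intruder y

theorem hideNonce_of_generatedBy {S : Set (Protocol V)} {α : Trace V} (x : V.IntruderAtom)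
    {n : Nonce V} (hn : GeneratedBy S α n) : hideNonce S α x n = n := by
  cases n with
  | fresh c rid => exact if_pos hn
  | intruder y => rfl

theorem hideNonce_of_not_generatedBy {S : Set (Protocol V)} {α : Trace V} (x : V.IntruderAtom)
    {n : Nonce V} (hn : ¬ GeneratedBy S α n) : ∃ y, hideNonce S α x n = .intruder y := by
  cases n with
  | fresh c rid => exact ⟨x, if_neg hn⟩
  | intruder y => exact ⟨y, rfl⟩

/-- Matching only instantiates and never tests for distinctness, so `θ` may identify nonces. -/
theorem Inst.Matches.mapNonce {inst inst' : Inst V} {m : RoleTerm V} {t : RunTerm V}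
    (h : inst.Matches m t inst') {θ : Nonce V → Nonce V}
    (hθ : ∀ c, inst'.typ c = .const → θ (.fresh c inst'.rid) = .fresh c inst'.rid) :
    (inst.mapNonce θ).Matches m (t.mapNonce θ) (inst'.mapNonce θ) := by
  obtain ⟨h₁, h₂, h₃, h₄, h₅, h₆⟩ := h
  refine ⟨h₁, h₂, h₃, fun c n hn => ?_, fun c => ?_, Inst.apply_mapNonce hθ h₆⟩
  · obtain ⟨k, hk, rfl⟩ := Option.map_eq_some_iff.1 hn
    exact Option.map_eq_some_iff.2 ⟨k, h₄ c k hk, rfl⟩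
  · simpa [Inst.mapNonce] using h₅ c

/-- A renaming of the nonces of a run. -/
def Run.mapNonce (θ : Nonce V → Nonce V) (run : Run V) : Run V :=
  ⟨run.inst.mapNonce θ, run.rest⟩

/-- The invariant of the simulation of a trace `β` by runs of `S₁` alone: the nonces are renamed
by `θ`, and the state `st'` covers the part of the state `st` with run identifiers in `R`. -/
structure Simulates (θ : Nonce V → Nonce V) (E : Set (RunTerm V)) (x : V.IntruderAtom)
    (R : Set V.RunId) (β : Trace V) (st : State V) (β' : Trace V) (st' : State V) : Prop where
  know : ∀ t ∈ st.know, t.weaken θ E (.intruder x) ∈ st'.know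
  runs : ∀ run ∈ st.runs, run.inst.rid ∈ R → run.mapNonce θ ∈ st'.runs
  rids : ∀ run' ∈ st'.runs, ∃ run ∈ st.runs, run.inst.rid = run'.inst.rid
  events : ∀ e ∈ β, e.inst.rid ∈ R → ⟨e.inst.mapNonce θ, e.ev⟩ ∈ β'

namespace Simulates

variable {θ : Nonce V → Nonce V} {E : Set (RunTerm V)} {x : V.IntruderAtom} {R : Set V.RunId}
  {β β' : Trace V} {st st' : State V}

theorem advance (h : Simulates θ E x R β st β' st')
    (huniq : ∀ run ∈ st.runs, ∀ run' ∈ st.runs, run.inst.rid = run'.inst.rid → run = run')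
    {run run₁ : Run V} (hrun : run ∈ st.runs) (hrid : run₁.inst.rid = run.inst.rid)
    {ev : Event V} {M M' : Set (RunTerm V)}
    (hM : ∀ t ∈ M, t.weaken θ E (.intruder x) ∈ M') :
    Simulates θ E x R (β ++ [⟨run₁.inst, ev⟩]) ⟨M, replaceRun st.runs run₁ run⟩
      (β' ++ [⟨run₁.inst.mapNonce θ, ev⟩])
      ⟨M', replaceRun st'.runs (run₁.mapNonce θ) (run.mapNonce θ)⟩ where
  know := hM
  runs := by
    rintro run₂ (rfl | hrun₂) hR
    · exact Or.inl rfl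
    -- Renaming could merge two runs, and removing one image would then lose the other; it preserves
    -- run identifiers, and these are unique.
    · refine Or.inr ⟨h.runs run₂ hrun₂.1 hR, fun heq => hrun₂.2 ?_⟩
      have heq : run₂.mapNonce θ = run.mapNonce θ := heq
      exact huniq _ hrun₂.1 _ hrun (congrArg (fun r : Run V => r.inst.rid) heq :)
  rids := by
    rintro run' (rfl | hrun')
    · exact ⟨run₁, Or.inl rfl, rfl⟩
    · obtain ⟨run₂, hrun₂, heq⟩ := h.rids run' hrun'.1
      by_cases hne : run₂ = run
      · exact ⟨run₁, Or.inl rfl, by rw [hrid, ← hne, heq]⟩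
      · exact ⟨run₂, Or.inr ⟨hrun₂, hne⟩, heq⟩
  events := by
    intro e he hR
    rcases List.mem_append.1 he with he | he
    · exact List.mem_append_left _ (h.events e he hR)
    · obtain rfl := List.mem_singleton.1 he
      exact List.mem_append_right _ (List.mem_singleton_self _)

theorem advance_of_notMem (h : Simulates θ E x R β st β' st')
    {run run₁ : Run V} (hrid : run₁.inst.rid = run.inst.rid) (hR : run₁.inst.rid ∉ R)
    {ev : Event V} {M : Set (RunTerm V)} (hM : ∀ t ∈ M, t.weaken θ E (.intruder x) ∈ st'.know) :
    Simulates θ E x R (β ++ [⟨run₁.inst, ev⟩]) ⟨M, replaceRun st.runs run₁ run⟩ β' st' where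
  know := hM
  runs := by
    rintro run₂ (rfl | hrun₂) hR'
    · exact absurd hR' hR
    · exact h.runs run₂ hrun₂.1 hR'
  rids := by
    intro run' hrun'
    obtain ⟨run₂, hrun₂, heq⟩ := h.rids run' hrun'
    by_cases hne : run₂ = run
    · exact ⟨run₁, Or.inl rfl, by rw [hrid, ← hne, heq]⟩
    · exact ⟨run₂, Or.inr ⟨hrun₂, hne⟩, heq⟩
  events := by
    intro e he hR'
    rcases List.mem_append.1 he with he | he
    · exact h.events e he hR'
    · obtain rfl := List.mem_singleton.1 he
      exact absurd hR' hR

theorem create (h : Simulates θ E x R β st β' st') {run : Run V} {ev : Event V} :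
    Simulates θ E x R (β ++ [⟨run.inst, ev⟩]) ⟨st.know, st.runs ∪ {run}⟩
      (β' ++ [⟨run.inst.mapNonce θ, ev⟩]) ⟨st'.know, st'.runs ∪ {run.mapNonce θ}⟩ where
  know := h.know
  runs := by
    rintro run₂ (hrun₂ | rfl) hR
    · exact Or.inl (h.runs run₂ hrun₂ hR)
    · exact Or.inr rfl
  rids := by
    rintro run' (hrun' | rfl)
    · obtain ⟨run₂, hrun₂, heq⟩ := h.rids run' hrun'
      exact ⟨run₂, Or.inl hrun₂, heq⟩
    · exact ⟨run, Or.inr rfl, rfl⟩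
  events := by
    intro e he hR
    rcases List.mem_append.1 he with he | he
    · exact List.mem_append_left _ (h.events e he hR)
    · obtain rfl := List.mem_singleton.1 he
      exact List.mem_append_right _ (List.mem_singleton_self _)

theorem create_of_notMem (h : Simulates θ E x R β st β' st') {run : Run V}
    (hR : run.inst.rid ∉ R) {ev : Event V} :
    Simulates θ E x R (β ++ [⟨run.inst, ev⟩]) ⟨st.know, st.runs ∪ {run}⟩ β' st' where
  know := h.know
  runs := by
    rintro run₂ (hrun₂ | rfl) hR'
    · exact h.runs run₂ hrun₂ hR'
    · exact absurd hR' hR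
  rids := by
    intro run' hrun'
    obtain ⟨run₂, hrun₂, heq⟩ := h.rids run' hrun'
    exact ⟨run₂, Or.inl hrun₂, heq⟩
  events := by
    intro e he hR'
    rcases List.mem_append.1 he with he | he
    · exact h.events e he hR'
    · obtain rfl := List.mem_singleton.1 he
      exact absurd hR' hR

end Simulates

/-- An initial run constrains only the domain of `sigma`, so parameter values may be renamed freely.
-/
theorem mapNonce_mem_initialRuns {S₁ S₂ : Set (Protocol V)} {inst : Inst V} {l : V.Label}
    {r : V.Role} {rest : List (Event V)} (hlabels : LabelIn S₁ l → ¬ LabelIn S₂ l)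
    (hl : LabelIn S₁ l) (h : ⟨inst, .create l r :: rest⟩ ∈ initialRuns (S₁ ∪ S₂))
    (θ : Nonce V → Nonce V) : ⟨inst.mapNonce θ, .create l r :: rest⟩ ∈ initialRuns S₁ := by
  obtain ⟨P, hP, r', rs, hr, hrest, htyp, hrho, hsigma⟩ := h
  have hrest : Event.create l r :: rest = rs.elist := hrest
  rcases hP with hP | hP
  · exact ⟨P, hP, r', rs, hr, hrest, htyp, hrho, by simpa [Inst.mapNonce] using hsigma⟩
  · exact absurd ⟨P, hP, r', rs, _, hr, hrest ▸ List.mem_cons_self, rfl⟩ (hlabels hl)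

/-- Each step of `S₁` is mirrored by its renamed version. Steps of `S₂` add nothing to the
simulating trace: the only ones that change the knowledge are sends, and their weakened messages are
already derivable. -/
theorem Separated.exists_simulates {S₁ S₂ : Set (Protocol V)} {α : Trace V}
    (h : Separated S₁ S₂ α) (x : V.IntruderAtom) {β : Trace V} {st : State V}
    (hst : Reaches (S₁ ∪ S₂) β st) (hβ : β <+: α) :
    ∃ β' st', Reaches S₁ β' st' ∧ Simulates (hideNonce S₁ α x) (sentEncryptionsOf S₂ α) x
      (createdRids S₁ α) β st β' st' := by
  induction hst with
  | nil =>
    exact ⟨[], _, .nil, fun t ht => weaken_mem_initialKnowledge (fun _ => rfl) _ _ ht,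
      by simp, by simp, by simp⟩
  | @snoc β st e st₁ hst hstep ih =>
    have hβα : β <+: α := (List.prefix_append _ _).trans hβ
    have heα : e ∈ α := hβ.subset (by simp)
    obtain ⟨β', ⟨M', F'⟩, hst', hsim⟩ := ih hβα
    have hside := h.mem_createdRids heα
    have hright : e.inst.rid ∈ createdRids S₂ α → e.inst.rid ∉ createdRids S₁ α :=
      fun h' => h.disjoint_createdRids.notMem_of_mem_right h'
    have hfix : e.inst.rid ∈ createdRids S₁ α → ∀ c, e.inst.typ c = .const →
        hideNonce S₁ α x (.fresh c e.inst.rid) = .fresh c e.inst.rid :=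
      fun hrid c hc => hideNonce_of_generatedBy x (h.generatedBy_fresh heα hrid hc)
    have huniq := hst.runs.2.2.1
    cases hstep with
    | @create M F inst l r rest hinit hnew =>
      rcases hside with ⟨hl, hrid⟩ | ⟨hl, hrid⟩
      · refine ⟨_, _, hst'.snoc (.create (mapNonce_mem_initialRuns (h.labels l) hl hinit _) ?_),
          hsim.create (run := ⟨inst, rest⟩)⟩
        -- The identifier is still unused, since simulating runs borrow their identifiers from
        -- active runs of the union.
        intro run hrun heq
        obtain ⟨run', hrun', heq'⟩ := hsim.rids run hrun
        exact hnew run' hrun' (heq'.trans heq)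
      · exact ⟨β', _, hst', hsim.create_of_notMem (run := ⟨inst, rest⟩) (hright hrid)⟩
    | @finish M F inst l r hrun =>
      rcases hside with ⟨hl, hrid⟩ | ⟨hl, hrid⟩
      · exact ⟨_, _, hst'.snoc (.finish (hsim.runs _ hrun hrid)),
          hsim.advance huniq (run₁ := ⟨inst, []⟩) hrun rfl hsim.know⟩
      · exact ⟨β', _, hst',
          hsim.advance_of_notMem (run := ⟨inst, [_]⟩)
            (run₁ := ⟨inst, []⟩) rfl (hright hrid) hsim.know⟩
    | @claim M F inst l r cl m rest hrun =>
      rcases hside with ⟨hl, hrid⟩ | ⟨hl, hrid⟩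
      · exact ⟨_, _, hst'.snoc (.claim (hsim.runs _ hrun hrid)),
          hsim.advance huniq (run₁ := ⟨inst, rest⟩) hrun rfl hsim.know⟩
      · exact ⟨β', _, hst',
          hsim.advance_of_notMem (run := ⟨inst, _ :: rest⟩)
            (run₁ := ⟨inst, rest⟩) rfl (hright hrid) hsim.know⟩
    | @read M F inst l s s' m rest t inst' hrun ht hm =>
      rcases hside with ⟨hl, hrid⟩ | ⟨hl, hrid⟩
      · have ht' := hsim.know t ht
        rw [Inst.weaken_eq_mapNonce _ _ (h.disjoint_left heα hl (Or.inl ⟨l, s, s', rfl⟩))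
          hm.2.2.2.2.2] at ht'
        exact ⟨_, _, hst'.snoc (.read (hsim.runs _ hrun (hm.1 ▸ hrid)) ht'
          (hm.mapNonce (hfix hrid))),
          hsim.advance huniq (run₁ := ⟨inst', rest⟩) hrun hm.1 hsim.know⟩
      · exact ⟨β', _, hst',
          hsim.advance_of_notMem (run := ⟨inst, _ :: rest⟩)
            (run₁ := ⟨inst', rest⟩) hm.1 (hright hrid) hsim.know⟩
    | @send M F inst l s s' m rest t hrun ht =>
      rcases hside with ⟨hl, hrid⟩ | ⟨hl, hrid⟩
      · have ht' := Inst.apply_mapNonce (hfix hrid) ht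
        have hst'' := hst'.snoc (.send (hsim.runs _ hrun hrid) ht')
        refine ⟨_, _, hst'', hsim.advance huniq (run₁ := ⟨inst, rest⟩) hrun rfl fun u hu =>
          weaken_mem_of_derivable ?_ (isClosedKnowledge_closure _)
            (hst''.initialKnowledge_subset (intruder_mem_initialKnowledge x)) hu⟩
        rintro u (hu | rfl)
        · exact subset_closure _ (Or.inl (hsim.know u hu))
        · rw [Inst.weaken_eq_mapNonce _ _
            (h.disjoint_left heα hl (Or.inr (Or.inl ⟨l, s, s', rfl⟩))) ht]
          exact subset_closure _ (Or.inr rfl)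
      · refine ⟨β', _, hst', hsim.advance_of_notMem (run := ⟨inst, _ :: rest⟩)
            (run₁ := ⟨inst, rest⟩) rfl (hright hrid)
          fun u hu => weaken_mem_of_derivable ?_ hst'.isClosedKnowledge
            (hst'.initialKnowledge_subset (intruder_mem_initialKnowledge x)) hu⟩
        -- A public nonce is either generated by `S₁`, hence known and fixed by the renaming, or
        -- renamed to an intruder atom.
        have hnonce : ∀ n, n ∈ publicNonces S₁ α M →
            RunTerm.nonce (hideNonce S₁ α x n) ∈ M' := by
          intro n hn
          by_cases hg : GeneratedBy S₁ α n
          · exact hsim.know _ (hn hg)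
          · obtain ⟨y, hy⟩ := hideNonce_of_not_generatedBy x hg
            rw [hy]
            exact hst'.initialKnowledge_subset (intruder_mem_initialKnowledge y)
        rintro u (hu | rfl)
        · exact hsim.know u hu
        · exact Inst.weaken_mem_of_apply (fun _ => rfl) hst'.isClosedKnowledge
            hst'.initialKnowledge_subset
            (fun c _ => hnonce _ fun hg => absurd hg (h.not_generatedBy_fresh hrid c))
            (fun c n hn => hnonce n ((h.sigma_mem_publicNonces hst hβα).2 _ hrun hrid c n hn))
            (h.not_isSecretKey heα ⟨l, s, s', rfl⟩)
            (fun v hv => ⟨_, heα, hl, m, ⟨l, s, s', rfl⟩, hv⟩) ht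

/-- An instance of a claimed term that is known in the trace of the union gives rise to a trace
of `S₁` in which the instance of the claimed term is known as well. -/
theorem Separated.exists_leak {S₁ S₂ : Set (Protocol V)} {α : Trace V}
    (h : Separated S₁ S₂ α) (x : V.IntruderAtom) {inst : Inst V} {l : V.Label} {r : V.Role}
    {cl : ClaimName V} {m : RoleTerm V} {t : RunTerm V} (hl : LabelIn S₁ l)
    (he : ⟨inst, .claim l r cl (some m)⟩ ∈ α) (ht : inst.apply m = some t)
    (hknow : t ∈ knowledgeAt (S₁ ∪ S₂) α α.length) :
    ∃ α' ∈ traces S₁, ∃ inst' t', ⟨inst', .claim l r cl (some m)⟩ ∈ α' ∧ inst'.rho = inst.rho ∧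
      inst'.apply m = some t' ∧ t' ∈ knowledgeAt S₁ α' α'.length := by
  obtain ⟨st, hst, hknow⟩ := hknow
  rw [List.take_length] at hst
  obtain ⟨α', st', hst', hsim⟩ := h.exists_simulates x hst List.prefix_rfl
  have hrid : inst.rid ∈ createdRids S₁ α := by
    rcases h.mem_createdRids he with h' | h'
    exacts [h'.2, absurd h'.1 (h.labels l hl)]
  have hmem := hsim.know t hknow
  rw [Inst.weaken_eq_mapNonce _ _ (h.disjoint_left he hl (Or.inr (Or.inr ⟨l, r, cl, rfl⟩))) ht]
    at hmem
  exact ⟨α', ⟨st', hst'⟩, _, _, hsim.events _ he hrid, rfl,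
    Inst.apply_mapNonce
      (fun c hc => hideNonce_of_generatedBy x (h.generatedBy_fresh he hrid hc)) ht,
    st', by rwa [List.take_length], hmem⟩

end SecProt

theorem mainTheorem1 (V : SecProt.Vocabulary) [Nonempty V.IntruderAtom]
    (S₁ S₂ : Set (SecProt.Protocol V))
    (hset : SecProt.IsProtocolSet (S₁ ∪ S₂))
    (hkeys : ∀ P ∈ S₁ ∪ S₂, SecProt.Protocol.SecretKeysOnlyAsKeys P)
    (χ : SecProt.Trace V → Prop)
    (hinput : ∀ α ∈ SecProt.traces (S₁ ∪ S₂), χ α → SecProt.NoPrivateInput S₁ S₂ α)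
    (hind : SecProt.Independent χ S₁ S₂)
    (l : V.Label) (hl : SecProt.IsSecrecyClaimLabel S₁ l)
    (hsat : SecProt.SatisfiesSecrecy (fun _ => True) S₁ l) :
    SecProt.SatisfiesSecrecy χ (S₁ ∪ S₂) l := by
  obtain ⟨x⟩ := ‹Nonempty V.IntruderAtom›
  obtain ⟨P, hP, r₀, rs, r', m₀, hr, hmem⟩ := hl
  have hlabel : SecProt.LabelIn S₁ l := ⟨P, hP, r₀, rs, _, hr, hmem, rfl⟩
  intro α hα hχ inst r m he
  by_contra hcon
  simp only [not_or, not_not, SecProt.secrecy, not_forall] at hcon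
  obtain ⟨⟨l', r'', cl, m', t, hev, ht, hknow⟩, htrusted⟩ := hcon
  obtain ⟨rfl, rfl, rfl, rfl⟩ := SecProt.Event.claim.inj hev
  have hsep := hind.separated hset hkeys hα hχ (hinput α hα hχ)
  -- The simulation leaves `rho` unchanged, so the agents of the claiming run remain trusted and the
  -- leak contradicts the claim in `S₁`.
  obtain ⟨α', hα', inst', t', he', hrho, ht', hknow'⟩ := hsep.exists_leak x hlabel he ht hknow
  rcases hsat α' hα' trivial inst' r _ he' with h' | h'
  · exact h' _ _ _ _ _ rfl ht' hknow'
  · exact h' fun r a ha => htrusted r a (hrho ▸ ha)
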